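/- Let $M$ be a smooth ($C^\infty$) Hausdorff manifold of finite dimension $n$, let $E=\mathbb R\times TM$ be its evolution space, with adapted local coordinates $(t,x^i,u^i)$, and let $\mathfrak X(E)$ be the smooth vector fields on $E$. Let $\theta^i=dx^i-u^i\,dt$, $V_i=\partial/\partial u^i$, and let $S=\theta^i\otimes V_i$ be the vertical endomorphism. Let $\Gamma=\partial_t+u^i\,\partial_{x^i}+F^i\,\partial_{u^i}$ be a smooth second-order differential equation field on $E$, i.e. a smooth vector field with $dt(\Gamma)=1$ and $\theta^i(\Gamma)=0$. Let $P_\Gamma,P_H,P_V$ be the projectors of $\mathfrak X(E)$ onto the eigenspaces of $\mathcal L_\Gamma S$ for the eigenvalues $0,-1,1$, given by $P_\Gamma=dt\otimes\Gamma$, $P_H=\frac12(I-dt\otimes\Gamma-\mathcal L_\Gamma S)$ and $P_V=\frac12(I-dt\otimes\Gamma+\mathcal L_\Gamma S)$. Let $Q$ be the $(1,1)$ tensor with values in $\operatorname{Im}P_H$ such that $Q\circ S=P_H$ and $S\circ Q=P_V$; explicitly $Q(X)=-P_H([\Gamma,P_V(X)])$. (That these operators have the stated properties is part of the claim.) Define,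 for $X,Y$ in the image of $P_\Gamma$, $P_H$, $P_V$ respectively, $$\nabla^\Gamma_XY=X(dt(Y))\,\Gamma,\qquad \nabla^H_XY=Q([X,S(Y)]),\qquad \nabla^V_XY=S([X,Q(Y)]),$$ and, for $A\in\{\Gamma,H,V\}$, $X\in\mathfrak X(E)$ and $Y\in\operatorname{Im}P_A$, $\bar\nabla^A_XY=\nabla^A_{P_A(X)}Y+P_A([X-P_A(X),Y])$. The Massa–Pagani connection is, for $X,Y\in\mathfrak X(E)$, $$\hat\nabla_XY=\bar\nabla^\Gamma_X(P_\Gamma(Y))+\bar\nabla^H_X(P_H(Y))+\bar\nabla^V_X(P_V(Y)).$$ **Proposition 3.3.** $\hat\nabla$ is a linear connection on $E$, and it is the unique linear connection $\nabla$ on $E$ (with torsion $T(X,Y)=\nabla_XY-\nabla_YX-[X,Y]$ and curvature $R(X,Y)Z=\nabla_X\nabla_YZ-\nabla_Y\nabla_XZ-\nabla_{[X,Y]}Z$) that satisfies all of the following: - $\nabla\Gamma=0$, $\nabla dt=0$, $\nabla S=0$, $\nabla Q=0$; - $P_H(X)=T(\Gamma,S(X))$ and $P_V(X)=S(T(\Gamma,X))$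 for all $X\in\mathfrak X(E)$; - $R(\Gamma,V)Z=0$ for every vertical vector field $V$ and every $Z\in\mathfrak X(E)$; - $\nabla_VU=0$ for every vertical vector field $V$ and every vertical vector field $U$ that is constant along the fibres of $E\to\mathbb R\times M$, i.e. every vertical lift $U=W^i(t,x)\,\partial/\partial u^i$ from $\mathbb R\times M$. -/

import Mathlib

open scoped Manifold ContDiff

noncomputable section

namespace Evolution

/-- The evolution space `E = ℝ × TM`, a point being `(t, (x, u))`. -/
abbrev Space (F M : Type*) [NormedAddCommGroup F] [NormedSpace ℝ F] [TopologicalSpace M]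
    [ChartedSpace F M] : Type _ :=
  ℝ × TangentBundle 𝓘(ℝ, F) M

/-- The model with corners of the manifold `ℝ × TM`. -/
abbrev model (F : Type*) [NormedAddCommGroup F] [NormedSpace ℝ F] :
    ModelWithCorners ℝ (ℝ × (F × F)) (ModelProd ℝ (ModelProd F F)) :=
  𝓘(ℝ, ℝ).prod 𝓘(ℝ, F).tangent

variable {F M : Type*} [NormedAddCommGroup F] [NormedSpace ℝ F]
  [TopologicalSpace M] [ChartedSpace F M] [IsManifold 𝓘(ℝ, F) ∞ M]

/-- The tangent space `T_p E`. -/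
abbrev TSpace (p : Space F M) : Type _ := TangentSpace (model F) p

/-- The tangent space `T_x M` at the base point `x` of `p = (t, (x, u))`. -/
abbrev BaseTSpace (p : Space F M) : Type _ := TangentSpace 𝓘(ℝ, F) p.2.proj

variable (F M) in
/-- Smooth vector fields on `E`. -/
abbrev VField : Type _ :=
  ContMDiffSection (model F) (ℝ × (F × F)) ∞ (fun p : Space F M => TSpace p)

variable (F M) in
/-- Smooth real functions on `E`. -/
abbrev Fun : Type _ := ContMDiffMap (model F) 𝓘(ℝ, ℝ) (Space F M) ℝ ∞

/-- The product `f X` of a smooth function and a smooth vector field. -/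
def mulField (f : Fun F M) (X : VField F M) : VField F M :=
  ⟨fun p => f p • X p, f.contMDiff.smul_section X.contMDiff⟩

theorem contMDiff_lieDeriv (X : VField F M) (f : Fun F M) :
    ContMDiff (model F) 𝓘(ℝ, ℝ) ∞ (fun p => (mfderiv (model F) 𝓘(ℝ, ℝ) f p (X p) : ℝ)) := by
  have h := (contMDiff_snd_tangentBundle_modelSpace ℝ 𝓘(ℝ, ℝ) (n := ∞)).comp
    ((f.contMDiff.contMDiff_tangentMap (m := ∞) le_rfl).comp X.contMDiff)
  exact h

/-- The derivative `X(f)` of a function along a vector field. -/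
def lieDeriv (X : VField F M) (f : Fun F M) : Fun F M :=
  ⟨fun p => (mfderiv (model F) 𝓘(ℝ, ℝ) f p (X p) : ℝ), contMDiff_lieDeriv X f⟩

/-- The Lie bracket `[X, Y]` of smooth vector fields. -/
def bracket [FiniteDimensional ℝ F] (X Y : VField F M) : VField F M :=
  ⟨VectorField.mlieBracket (model F) X Y, by
    have : IsManifold (model F) (((⊤ : ℕ∞) : ℕ∞ω) + 1) (Space F M) :=
      inferInstanceAs (IsManifold (model F) ∞ (Space F M))
    have : IsManifold (model F) (minSmoothness ℝ 2) (Space F M) := by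
      rw [minSmoothness_of_isRCLikeNormedField]; infer_instance
    exact ContDiff.mlieBracket_vectorField (m := ⊤) (n := ⊤) X.contMDiff Y.contMDiff (by simp)⟩

/-- `π_{M*} : T_p E → T_x M`. -/
def dbase (p : Space F M) : TSpace p →L[ℝ] BaseTSpace p :=
  mfderiv (model F) 𝓘(ℝ, F) (fun q : Space F M => q.2.proj) p

/-- The one-form `dt`, pointwise. -/
def dtAt (p : Space F M) : TSpace p →L[ℝ] ℝ :=
  mfderiv (model F) 𝓘(ℝ, ℝ) (fun q : Space F M => q.1) p

/-- The contact form `θ = θ^i ⊗ ∂/∂x^i = (dx^i - u^i dt) ⊗ ∂/∂x^i`, with values in `T_x M`. -/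
def contactAt (p : Space F M) (ξ : TSpace p) : BaseTSpace p :=
  dbase p ξ - dtAt p ξ • p.2.snd

/-- The vertical lift `T_x M → T_p E`, `w^i ∂/∂x^i ↦ w^i ∂/∂u^i`: the derivative at `u` of the
inclusion `w ↦ (t, (x, w))` of the fibre through `p = (t, (x, u))`. -/
def vlift (p : Space F M) : BaseTSpace p →L[ℝ] TSpace p :=
  (mfderiv 𝓘(ℝ, F) (model F)
    (fun w : F => ((p.1, ⟨p.2.proj, w⟩) : Space F M)) p.2.snd : F →L[ℝ] TSpace p)

open Bundle in
theorem extChartAt_fibre (p₀ p : Space F M) (w : F) :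
    extChartAt (model F) p₀ ((p.1, ⟨p.2.proj, w⟩) : Space F M) =
      (p.1, (extChartAt 𝓘(ℝ, F) p₀.2.proj p.2.proj,
        (trivializationAt F (TangentSpace 𝓘(ℝ, F)) p₀.2.proj ⟨p.2.proj, w⟩).2)) := by
  rfl

open Bundle in
theorem triv_eq (x₀ x : M) (hx : x ∈ (chartAt F x₀).source) (w : TangentSpace 𝓘(ℝ, F) x) :
    (trivializationAt F (TangentSpace 𝓘(ℝ, F)) x₀ ⟨x, w⟩).2 =
      (trivializationAt F (TangentSpace 𝓘(ℝ, F)) x₀).continuousLinearMapAt ℝ x w := by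
  rw [Trivialization.continuousLinearMapAt_apply, Trivialization.linearMapAt_apply, if_pos]
  exact hx

open Bundle in
theorem contMDiff_fibre (p : Space F M) :
    ContMDiff 𝓘(ℝ, F) (model F) ∞ (fun w : F => ((p.1, ⟨p.2.proj, w⟩) : Space F M)) := by
  refine contMDiff_const.prodMk ?_
  intro w
  refine contMDiffAt_totalSpace.2 ⟨contMDiffAt_const, ?_⟩
  let A : F →L[ℝ] F := (trivializationAt F (TangentSpace 𝓘(ℝ, F)) p.2.proj).continuousLinearMapAt ℝ p.2.proj
  refine (A.contMDiff (n := ∞)).contMDiffAt.congr_of_eventuallyEq ?_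
  exact Filter.Eventually.of_forall
    fun w => triv_eq p.2.proj p.2.proj (mem_chart_source F p.2.proj) w

open Bundle in
theorem mfderiv_chart_vlift (p₀ p : Space F M) (hp : p ∈ (chartAt (ModelProd ℝ (ModelProd F F)) p₀).source)
    (hx : p.2.proj ∈ (chartAt F p₀.2.proj).source) (w : BaseTSpace p) :
    (mfderiv (model F) 𝓘(ℝ, ℝ × (F × F)) (extChartAt (model F) p₀) p (vlift p w) : ℝ × (F × F)) =
      (0, (0, (trivializationAt F (TangentSpace 𝓘(ℝ, F)) p₀.2.proj ⟨p.2.proj, w⟩).2)) := by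
  let A : F →L[ℝ] F :=
    (trivializationAt F (TangentSpace 𝓘(ℝ, F)) p₀.2.proj).continuousLinearMapAt ℝ p.2.proj
  let u : F := p.2.snd
  let j : F → Space F M := fun w => (p.1, ⟨p.2.proj, w⟩)
  have h1 : MDifferentiableAt (model F) 𝓘(ℝ, ℝ × (F × F)) (extChartAt (model F) p₀) (j u) :=
    mdifferentiableAt_extChartAt hp
  have h2 : MDifferentiableAt 𝓘(ℝ, F) (model F) j u :=
    (contMDiff_fibre p).mdifferentiable (by simp) u
  have h4 : (extChartAt (model F) p₀ ∘ j) =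
      fun w : F => ((p.1, (extChartAt 𝓘(ℝ, F) p₀.2.proj p.2.proj, A w)) : ℝ × (F × F)) := by
    funext w
    have a := triv_eq p₀.2.proj p.2.proj hx w
    exact (extChartAt_fibre p₀ p w).trans
      (congrArg (fun z : F => ((p.1, (extChartAt 𝓘(ℝ, F) p₀.2.proj p.2.proj, z)) : ℝ × (F × F))) a)
  have h5 : HasFDerivAt
      (fun w : F => ((p.1, (extChartAt 𝓘(ℝ, F) p₀.2.proj p.2.proj, A w)) : ℝ × (F × F)))
      ((0 : F →L[ℝ] ℝ).prod ((0 : F →L[ℝ] F).prod A)) u :=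
    (hasFDerivAt_const _ _).prodMk ((hasFDerivAt_const _ _).prodMk A.hasFDerivAt)
  have h6 : mfderiv 𝓘(ℝ, F) 𝓘(ℝ, ℝ × (F × F)) (extChartAt (model F) p₀ ∘ j) u =
      (0 : F →L[ℝ] ℝ).prod ((0 : F →L[ℝ] F).prod A) := by
    rw [h4, mfderiv_eq_fderiv, h5.fderiv]
  have h7 := (mfderiv_comp u h1 h2).symm.trans h6
  have h8 := congrArg (fun L : F →L[ℝ] ℝ × (F × F) => L w) h7
  have a := triv_eq p₀.2.proj p.2.proj hx w
  exact h8.trans (congrArg (fun z : F => (((0 : ℝ), ((0 : F), z)) : ℝ × (F × F))) a.symm)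

open Bundle in
theorem contMDiff_vertical (X : VField F M) :
    ContMDiff (model F) ((model F).prod 𝓘(ℝ, ℝ × (F × F))) ∞
      (fun p : Space F M => TotalSpace.mk' (ℝ × (F × F)) (E := fun p : Space F M => TSpace p) p
        (vlift p (contactAt p (X p)))) := by
  intro p₀
  refine (contMDiffAt_section p₀).2 ?_
  let e := trivializationAt F (TangentSpace 𝓘(ℝ, F) : M → Type _) p₀.2.proj
  have hproj : ContMDiff (model F) 𝓘(ℝ, F) ∞ (fun q : Space F M => q.2.proj) :=
    (contMDiff_proj (TangentSpace 𝓘(ℝ, F) : M → Type _)).comp contMDiff_snd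
  have hT : ContMDiff (model F) 𝓘(ℝ, ℝ) ∞ (fun p : Space F M => dtAt p (X p)) :=
    contMDiff_lieDeriv X ⟨fun q => q.1, contMDiff_fst⟩
  have h1 : ContMDiffAt (model F) 𝓘(ℝ, F) ∞
      (fun p : Space F M => (e ⟨p.2.proj, dbase p (X p)⟩).2) p₀ :=
    (contMDiffAt_totalSpace.1
      (((hproj.contMDiff_tangentMap (m := ∞) le_rfl).comp X.contMDiff) p₀)).2
  have h2 : ContMDiffAt (model F) 𝓘(ℝ, F) ∞ (fun p : Space F M => (e p.2).2) p₀ :=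
    (contMDiffAt_totalSpace.1
      ((contMDiff_snd : ContMDiff (model F) 𝓘(ℝ, F).tangent ∞ (fun p : Space F M => p.2)) p₀)).2
  have h3 : ContMDiffAt (model F) 𝓘(ℝ, ℝ × (F × F)) ∞
      (fun p : Space F M => (((0 : ℝ), ((0 : F),
        (e ⟨p.2.proj, dbase p (X p)⟩).2 - dtAt p (X p) • (e p.2).2)) : ℝ × (F × F))) p₀ := by
    refine ContMDiffAt.prodMk_space contMDiffAt_const (contMDiffAt_const.prodMk_space ?_)
    exact h1.sub ((hT p₀).smul h2)
  refine h3.congr_of_eventuallyEq ?_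
  have hs : ∀ᶠ p in nhds p₀, p ∈ (chartAt (ModelProd ℝ (ModelProd F F)) p₀).source :=
    (chartAt (ModelProd ℝ (ModelProd F F)) p₀).open_source.mem_nhds
      (mem_chart_source (ModelProd ℝ (ModelProd F F)) p₀)
  have hb : ∀ᶠ p in nhds p₀, p.2.proj ∈ (chartAt F p₀.2.proj).source :=
    hproj.continuous.continuousAt.eventually
      ((chartAt F p₀.2.proj).open_source.mem_nhds (mem_chart_source F p₀.2.proj))
  filter_upwards [hs, hb] with p hp hx
  have k1 := mfderiv_chart_vlift p₀ p hp hx (contactAt p (X p))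
  have k2 := TangentBundle.continuousLinearMapAt_trivializationAt (I := model F) hp
  have k3 : (trivializationAt (ℝ × (F × F)) (fun p : Space F M => TSpace p) p₀
      ⟨p, vlift p (contactAt p (X p))⟩).2 =
      (trivializationAt (ℝ × (F × F)) (TangentSpace (model F)) p₀).continuousLinearMapAt ℝ p
        (vlift p (contactAt p (X p))) := by
    rw [Trivialization.continuousLinearMapAt_apply, Trivialization.linearMapAt_apply, if_pos]
    exact hp
  have k4 : (e ⟨p.2.proj, contactAt p (X p)⟩).2 =
      (e ⟨p.2.proj, dbase p (X p)⟩).2 - dtAt p (X p) • (e p.2).2 := by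
    have a1 := triv_eq p₀.2.proj p.2.proj hx (dbase p (X p))
    have a2 := triv_eq p₀.2.proj p.2.proj hx p.2.snd
    have a3 := triv_eq p₀.2.proj p.2.proj hx (contactAt p (X p))
    refine a3.trans ?_
    rw [contactAt, map_sub, map_smul, ← a1, ← a2]
  rw [k3, k2]
  refine k1.trans ?_
  rw [k4]

/-- The vertical endomorphism `S = θ^i ⊗ ∂/∂u^i`. -/
def vertEndo (X : VField F M) : VField F M :=
  ⟨fun p => vlift p (contactAt p (X p)), contMDiff_vertical X⟩

/-- The function `t` on `E`. -/
def timeFun : Fun F M := ⟨fun q => q.1, contMDiff_fst⟩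

/-- The function `dt(X)`. -/
def dt (X : VField F M) : Fun F M := lieDeriv X timeFun

/-- `Γ` is a second-order differential equation field: it annihilates the contact forms and is
normalized by `dt(Γ) = 1`, i.e. `Γ = ∂/∂t + u^i ∂/∂x^i + F^i ∂/∂u^i` in adapted coordinates. -/
structure IsSODE (Γ : VField F M) : Prop where
  dt_eq_one : ∀ p, dtAt p (Γ p) = 1
  contact_eq_zero : ∀ p, contactAt p (Γ p) = 0

/-- `X` is vertical: it is in the kernel of the differential of `E → ℝ × M`. -/
def IsVertical (X : VField F M) : Prop :=
  ∀ p : Space F M, mfderiv (model F) (𝓘(ℝ, ℝ).prod 𝓘(ℝ, F))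
    (fun q : Space F M => (q.1, q.2.proj)) p (X p) = 0

/-- `U` is vertical and constant along the fibres of `E → ℝ × M`: it is the vertical lift
`W^i(t, x) ∂/∂u^i` of some `W(t, x) = W^i(t, x) ∂/∂x^i`. -/
def IsVerticalLift (U : VField F M) : Prop :=
  ∃ W : ∀ q : ℝ × M, TangentSpace 𝓘(ℝ, F) q.2,
    ∀ p : Space F M, U p = vlift p (W (p.1, p.2.proj))

/-- Koszul's axioms for a linear connection `D X Y = ∇_X Y`; real linearity in both arguments
is the case of a constant function `f`. -/
structure IsLinearConnection (D : VField F M → VField F M → VField F M) : Prop where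
  add_left : ∀ X X' Y, D (X + X') Y = D X Y + D X' Y
  mul_left : ∀ (f : Fun F M) X Y, D (mulField f X) Y = mulField f (D X Y)
  add_right : ∀ X Y Y', D X (Y + Y') = D X Y + D X Y'
  leibniz : ∀ (f : Fun F M) X Y,
    D X (mulField f Y) = mulField (lieDeriv X f) Y + mulField f (D X Y)

variable [FiniteDimensional ℝ F]

/-- The torsion `T(X, Y) = ∇_X Y - ∇_Y X - [X, Y]`. -/
def torsion (D : VField F M → VField F M → VField F M) (X Y : VField F M) : VField F M :=
  D X Y - D Y X - bracket X Y

/-- The curvature `R(X, Y)Z = ∇_X ∇_Y Z - ∇_Y ∇_X Z - ∇_[X,Y] Z`. -/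
def curvature (D : VField F M → VField F M → VField F M) (X Y Z : VField F M) : VField F M :=
  D X (D Y Z) - D Y (D X Z) - D (bracket X Y) Z

/-- The deformation `L_Γ S`, that is `(L_Γ S)(X) = [Γ, S X] - S [Γ, X]`. -/
def lieVertEndo (Γ X : VField F M) : VField F M :=
  bracket Γ (vertEndo X) - vertEndo (bracket Γ X)

/-- `P_Γ = dt ⊗ Γ`. -/
def projΓ (Γ X : VField F M) : VField F M := mulField (dt X) Γ

/-- `P_V = (I - dt ⊗ Γ + L_Γ S) / 2`. -/
def projV (Γ X : VField F M) : VField F M :=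
  (1 / 2 : ℝ) • (X - mulField (dt X) Γ + lieVertEndo Γ X)

/-- `P_H = (I - dt ⊗ Γ - L_Γ S) / 2`. -/
def projH (Γ X : VField F M) : VField F M :=
  (1 / 2 : ℝ) • (X - mulField (dt X) Γ - lieVertEndo Γ X)

/-- The tensor `Q = ψ^i ⊗ H_i`, in the form `Q(X) = -P_H [Γ, P_V X]`; this is tensorial, and
`[Γ, V_i] = -H_i + Γ^j_i V_j` gives `Q(V_i) = H_i`. -/
def horEndo (Γ X : VField F M) : VField F M := - projH Γ (bracket Γ (projV Γ X))

/-- `PΓ`, `PH`, `PV` are the projectors of the decomposition of vector fields into the eigenspaces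
of `L_Γ S` for the eigenvalues `0`, `-1`, `1`, and `Q` takes values in the image of `PH` and
satisfies `Q ∘ S = PH` and `S ∘ Q = PV`. These properties determine the four maps. -/
structure IsAdaptedSplitting (Γ : VField F M) (PΓ PH PV Q : VField F M → VField F M) : Prop where
  sum_eq : ∀ X, PΓ X + PH X + PV X = X
  eigen_zero : ∀ X, lieVertEndo Γ (PΓ X) = 0
  eigen_neg_one : ∀ X, lieVertEndo Γ (PH X) = - PH X
  eigen_one : ∀ X, lieVertEndo Γ (PV X) = PV X
  hor_Q : ∀ X, PH (Q X) = Q X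
  Q_comp_S : ∀ X, Q (vertEndo X) = PH X
  S_comp_Q : ∀ X, vertEndo (Q X) = PV X

/-- The extension `∇_{P X} Y + P [X - P X, Y]` of a covariant derivative on the image of a
projector `P`. -/
def extendDeriv (P : VField F M → VField F M) (D : VField F M → VField F M → VField F M)
    (X Y : VField F M) : VField F M :=
  D (P X) Y + P (bracket (X - P X) Y)

/-- `∇^Γ_X Y = X(dt(Y)) Γ`, on the image of `P_Γ`. -/
def derivΓ (Γ X Y : VField F M) : VField F M := mulField (lieDeriv X (dt Y)) Γ

/-- `∇^H_X Y = Q [X, S Y]`, on the image of `P_H`. -/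
def derivH (Γ X Y : VField F M) : VField F M := horEndo Γ (bracket X (vertEndo Y))

/-- `∇^V_X Y = S [X, Q Y]`, on the image of `P_V`. -/
def derivV (Γ X Y : VField F M) : VField F M := vertEndo (bracket X (horEndo Γ Y))

/-- The Massa-Pagani connection, glued from the three submodule derivatives. -/
def massaPagani (Γ X Y : VField F M) : VField F M :=
  extendDeriv (projΓ Γ) (derivΓ Γ) X (projΓ Γ Y) +
    extendDeriv (projH Γ) (derivH Γ) X (projH Γ Y) +
    extendDeriv (projV Γ) (derivV Γ) X (projV Γ Y)

/-- The conditions on a connection `D X Y = ∇_X Y`: `∇Γ = 0`, `∇dt = 0`, `∇S = 0`, `∇Q = 0`,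
`P_H(X) = T(Γ, S X)`, `P_V(X) = S T(Γ, X)`, `R(Γ, V) = 0` for vertical `V`, and `∇_V U = 0` for
vertical `V` and vertical lifts `U`. -/
structure MassaPaganiConditions (Γ : VField F M)
    (D : VField F M → VField F M → VField F M) : Prop where
  parallel_Γ : ∀ X, D X Γ = 0
  parallel_dt : ∀ X Y, lieDeriv X (dt Y) - dt (D X Y) = 0
  parallel_S : ∀ X Y, D X (vertEndo Y) - vertEndo (D X Y) = 0
  parallel_Q : ∀ X Y, D X (horEndo Γ Y) - horEndo Γ (D X Y) = 0
  torsion_H : ∀ X, projH Γ X = torsion D Γ (vertEndo X)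
  torsion_V : ∀ X, projV Γ X = vertEndo (torsion D Γ X)
  curvature_vertical : ∀ V, IsVertical V → ∀ Z, curvature D Γ V Z = 0
  vertical_flat : ∀ V U, IsVertical V → IsVerticalLift U → D V U = 0

end Evolution
end

/-! ### Algebra of the vertical endomorphism and of the splitting defined by `Γ`. -/

noncomputable section

/-! The geometry enters only through a few facts about vector fields acting as derivations on
functions: a field is determined by its action on `t`, on functions `f` from `M` and on the
velocities `Γ f`, and `S` turns the action on `f` into the action on `Γ f`. Everything else is
formal calculation in a module with a Lie bracket.

Testing on these functions gives the three basic identities: `S[Γ, V] = -V` for vertical `V`; `[S X,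
S Y] = S[S X, Y] + S[X, S Y]` on the kernel of `dt` (`lie_S_S`); and `S[X, U] = [S X, U]` for
vertical lifts `U` (`lie_lift`). The first yields the eigenvalues of `L_Γ S`, hence the projectors
and `Q`. Bracketing the second with `Γ` yields `projV_lie_S_add`, which together with the Jacobi
identity is exactly the vanishing of `R(Γ, V)` on vertical fields (`curv_vert`); `∇Q = 0` and `∇Γ =
0` carry this to all fields. The third gives `∇_V U = 0`.

For uniqueness (`eq_conn`), parallel `Γ` and `Q` reduce `∇_X` to its values on vertical fields. The
torsion condition fixes `∇_Γ`, the lifts fix `∇_V`, and `R(Γ, V) = 0` then fixes `∇_[Γ,V]`; since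
`P_H[Γ, S X] = -P_H X`, the directions `Γ`, `V` and `[Γ, V]` span everything.

The geometric half checks the axioms on `ℝ × TM`, with bump functions producing enough global
functions and lifts. -/

/-- The algebraic structure on the module `L` of vector fields of the evolution space, over its
ring `R` of functions, that is given by a second-order field `Γ`: the action of vector fields on
functions, the vertical endomorphism `S`, the time function, the functions `base` coming from the
configuration manifold, and the vertical lifts. A vector field is determined by its action on
`time`, on `base`, and on the velocities `Γ f` with `f` in `base`. -/
structure SecondOrderStructure (R L : Type*) [CommRing R] [Algebra ℝ R] [LieRing L] [Module ℝ L]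
    [Module R L] [IsScalarTower ℝ R L] where
  anchor : L →ₗ[R] Derivation ℝ R R
  lie_smul' : ∀ (X : L) (f : R) (Y : L), ⁅X, f • Y⁆ = anchor X f • Y + f • ⁅X, Y⁆
  anchor_lie : ∀ (X Y : L) (f : R), anchor ⁅X, Y⁆ f = anchor X (anchor Y f) - anchor Y (anchor X f)
  S : L →ₗ[R] L
  Γ : L
  time : R
  base : Set R
  IsLift : L → Prop
  anchor_Γ_time : anchor Γ time = 1
  anchor_S_time : ∀ X, anchor (S X) time = 0
  anchor_S_base : ∀ X, ∀ f ∈ base, anchor (S X) f = 0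
  anchor_S_velocity : ∀ X, ∀ f ∈ base,
    anchor (S X) (anchor Γ f) = anchor X f - anchor X time * anchor Γ f
  eq_zero : ∀ X, anchor X time = 0 → (∀ f ∈ base, anchor X f = 0) →
    (∀ f ∈ base, anchor X (anchor Γ f) = 0) → X = 0
  lift_time : ∀ U, IsLift U → anchor U time = 0
  lift_base : ∀ U, IsLift U → ∀ f ∈ base, anchor U f = 0
  -- For `U = W^i ∂/∂u^i` the function `U(Γ f) = W(f)` is constant along the fibres.
  lift_velocity : ∀ U, IsLift U → ∀ X, ∀ f ∈ base, anchor (S X) (anchor U (anchor Γ f)) = 0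
  -- A global, chart-free form of the fact that lifts locally span the vertical fields.
  lift_span : ∀ δ : L →ₗ[R] L, (∀ U, IsLift U → δ U = 0) → ∀ X, δ (S X) = 0

namespace SecondOrderStructure

variable {R L : Type*} [CommRing R] [Algebra ℝ R] [LieRing L] [Module ℝ L]
    [Module R L] [IsScalarTower ℝ R L] (A : SecondOrderStructure R L)

theorem smul_lie' (f : R) (X Y : L) : ⁅f • X, Y⁆ = f • ⁅X, Y⁆ - A.anchor Y f • X := by
  rw [← lie_skew, A.lie_smul', ← lie_skew X Y]
  module

/-- The one-form `dt`. -/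
def dt : L →ₗ[R] R where
  toFun X := A.anchor X A.time
  map_add' X Y := by simp
  map_smul' f X := by simp

theorem dt_apply (X : L) : A.dt X = A.anchor X A.time := rfl

theorem eq_of_anchor {X Y : L} (h : A.dt X = A.dt Y)
    (hb : ∀ f ∈ A.base, A.anchor X f = A.anchor Y f)
    (hv : ∀ f ∈ A.base, A.anchor X (A.anchor A.Γ f) = A.anchor Y (A.anchor A.Γ f)) : X = Y := by
  rw [← sub_eq_zero]
  apply A.eq_zero
  · rw [map_sub, Derivation.sub_apply, sub_eq_zero]; exact h
  · intro f hf; rw [map_sub, Derivation.sub_apply, hb f hf, sub_self]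
  · intro f hf; rw [map_sub, Derivation.sub_apply, hv f hf, sub_self]

@[simp] theorem dt_Γ : A.dt A.Γ = 1 := A.anchor_Γ_time

@[simp] theorem dt_S (X : L) : A.dt (A.S X) = 0 := A.anchor_S_time X

theorem dt_lie (X Y : L) : A.dt ⁅X, Y⁆ = A.anchor X (A.dt Y) - A.anchor Y (A.dt X) :=
  A.anchor_lie X Y A.time


@[simp] theorem S_S (X : L) : A.S (A.S X) = 0 := by
  apply A.eq_of_anchor
  · simp
  · intro f hf; simp [A.anchor_S_base _ f hf]
  · intro f hf; simp [A.anchor_S_velocity _ f hf, A.anchor_S_base _ f hf, A.anchor_S_time]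

@[simp] theorem S_Γ : A.S A.Γ = 0 := by
  apply A.eq_of_anchor
  · simp
  · intro f hf; simp [A.anchor_S_base _ f hf]
  · intro f hf; simp [A.anchor_S_velocity _ f hf, A.anchor_Γ_time]

/-- The vertical fields. -/
def IsVert (X : L) : Prop := A.dt X = 0 ∧ A.S X = 0

variable {A}

theorem isVert_S (X : L) : A.IsVert (A.S X) := ⟨A.dt_S X, A.S_S X⟩

theorem IsVert.anchor_base {X : L} (hX : A.IsVert X) {f : R} (hf : f ∈ A.base) :
    A.anchor X f = 0 := by
  have h := A.anchor_S_velocity X f hf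
  rw [hX.2, ← dt_apply, hX.1] at h
  simpa using h.symm

/-- On a velocity, `S[Γ, X]` acts as `[Γ, X] f = Γ(X f) - X(Γ f)`, and `X f = 0`. -/
theorem IsVert.S_lie_Γ {X : L} (hX : A.IsVert X) : A.S ⁅A.Γ, X⁆ = -X := by
  apply A.eq_of_anchor
  · simp [hX.1]
  · intro f hf; simp [A.anchor_S_base _ f hf, hX.anchor_base hf]
  · intro f hf
    rw [A.anchor_S_velocity _ f hf, ← A.dt_apply, A.dt_lie, A.anchor_lie, hX.1,
      hX.anchor_base hf]
    simp

variable (A)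

/-- This is the vanishing of the Nijenhuis torsion of `S` on the kernel of `dt`; the usual term
`S²[X, Y]` is absent because `S² = 0`. On a velocity `Γ f` both sides give `S X (Y f) - S Y (X f)`.
-/
theorem lie_S_S {X Y : L} (hX : A.dt X = 0) (hY : A.dt Y = 0) :
    ⁅A.S X, A.S Y⁆ = A.S ⁅A.S X, Y⁆ + A.S ⁅X, A.S Y⁆ := by
  apply A.eq_of_anchor
  · simp [A.dt_lie]
  · intro f hf; simp [A.anchor_lie, A.anchor_S_base _ f hf]
  · intro f hf
    simp only [map_add, Derivation.add_apply, A.anchor_S_velocity _ f hf, A.anchor_lie,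
      A.anchor_S_base _ f hf, ← A.dt_apply, hX, hY, dt_S, map_zero]
    ring_nf

/-- A vertical lift preserves `S` on the kernel of `dt`: on a velocity both sides give `-U(X f)`,
since `S X` kills `U(Γ f)`. -/
theorem lie_lift {U X : L} (hU : A.IsLift U) (hX : A.dt X = 0) : A.S ⁅X, U⁆ = ⁅A.S X, U⁆ := by
  have hU0 : A.dt U = 0 := A.lift_time U hU
  apply A.eq_of_anchor
  · simp [A.dt_lie, hU0]
  · intro f hf; simp [A.anchor_lie, A.anchor_S_base _ f hf, A.lift_base U hU f hf]
  · intro f hf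
    simp only [A.anchor_S_velocity _ f hf, A.anchor_lie, A.lift_velocity U hU _ f hf,
      ← A.dt_apply, hX, hU0, A.lift_base U hU f hf, map_zero]
    ring_nf

/-- The deformation `L_Γ S`. -/
def lieS : L →ₗ[R] L where
  toFun X := ⁅A.Γ, A.S X⁆ - A.S ⁅A.Γ, X⁆
  map_add' X Y := by simp; abel
  map_smul' f X := by
    simp only [map_smul, A.lie_smul', map_add, RingHom.id_apply]
    module

theorem lieS_apply (X : L) : A.lieS X = ⁅A.Γ, A.S X⁆ - A.S ⁅A.Γ, X⁆ := rfl

variable {A} in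
theorem IsVert.lieS_eq {X : L} (hX : A.IsVert X) : A.lieS X = X := by
  rw [lieS_apply, hX.2, hX.S_lie_Γ]; simp

@[simp] theorem lieS_Γ : A.lieS A.Γ = 0 := by simp [lieS_apply]

@[simp] theorem S_lieS (X : L) : A.S (A.lieS X) = -A.S X := by
  rw [lieS_apply, map_sub, (isVert_S X).S_lie_Γ]; simp

@[simp] theorem dt_lieS (X : L) : A.dt (A.lieS X) = 0 := by
  simp [lieS_apply, A.dt_lie]

/-- The field `L_Γ S(X) + X - dt(X) Γ` is killed by `dt` and by `S`, and `L_Γ S` is the identity on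
such fields. The eigenvalues `0`, `±1` follow. -/
theorem lieS_lieS (X : L) : A.lieS (A.lieS X) = X - A.dt X • A.Γ := by
  have h : A.IsVert (A.lieS X + X - A.dt X • A.Γ) := ⟨by simp, by simp⟩
  have h' := h.lieS_eq
  simp only [map_sub, map_add, map_smul, lieS_Γ] at h'
  linear_combination (norm := module) h'

/-- `P_Γ`. -/
def projΓ : L →ₗ[R] L := A.dt.smulRight A.Γ

/-- `P_V`. -/
def projV : L →ₗ[R] L :=
  -- The scalar is taken in `R` to have an `R`-linear map; `projV_apply` returns to the real scalar.
  algebraMap ℝ R (1 / 2) • (LinearMap.id - A.projΓ + A.lieS)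

/-- `P_H`. -/
def projH : L →ₗ[R] L :=
  algebraMap ℝ R (1 / 2) • (LinearMap.id - A.projΓ - A.lieS)

theorem projΓ_apply (X : L) : A.projΓ X = A.dt X • A.Γ := rfl

theorem projV_apply (X : L) : A.projV X = (1 / 2 : ℝ) • (X - A.dt X • A.Γ + A.lieS X) :=
  algebraMap_smul R (1 / 2 : ℝ) (X - A.dt X • A.Γ + A.lieS X)

theorem projH_apply (X : L) : A.projH X = (1 / 2 : ℝ) • (X - A.dt X • A.Γ - A.lieS X) :=
  algebraMap_smul R (1 / 2 : ℝ) (X - A.dt X • A.Γ - A.lieS X)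

theorem algebraMap_half_mul_two : algebraMap ℝ R (1 / 2) * 2 = 1 := by
  rw [← map_ofNat (algebraMap ℝ R), ← map_mul]; norm_num

theorem map_real_smul {N : Type*} [AddCommGroup N] [Module R N] [Module ℝ N] [IsScalarTower ℝ R N]
    (φ : L →ₗ[R] N) (c : ℝ) (X : L) : φ (c • X) = c • φ X := by
  rw [← algebraMap_smul R c X, map_smul, algebraMap_smul]

theorem proj_sum (X : L) : A.projΓ X + A.projH X + A.projV X = X := by
  rw [projΓ_apply, projH_apply, projV_apply]
  match_scalars
  · linear_combination -(A.dt X) * algebraMap_half_mul_two (R := R)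
  · linear_combination algebraMap_half_mul_two (R := R)
  · ring

@[simp] theorem dt_projΓ (X : L) : A.dt (A.projΓ X) = A.dt X := by simp [projΓ_apply]
@[simp] theorem dt_projV (X : L) : A.dt (A.projV X) = 0 := by
  simp [projV_apply]
@[simp] theorem dt_projH (X : L) : A.dt (A.projH X) = 0 := by
  simp [projH_apply]
@[simp] theorem S_projV (X : L) : A.S (A.projV X) = 0 := by
  simp [projV_apply]
@[simp] theorem S_projH (X : L) : A.S (A.projH X) = A.S X := by
  rw [projH_apply, map_real_smul]; simp only [map_sub, map_smul, S_Γ, S_lieS]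
  match_scalars
  linear_combination algebraMap_half_mul_two (R := R)
@[simp] theorem projV_Γ : A.projV A.Γ = 0 := by simp [projV_apply]
@[simp] theorem projH_Γ : A.projH A.Γ = 0 := by simp [projH_apply]
theorem projΓ_eq_zero {X : L} (hX : A.dt X = 0) : A.projΓ X = 0 := by simp [projΓ_apply, hX]

theorem isVert_projV (X : L) : A.IsVert (A.projV X) := ⟨A.dt_projV X, A.S_projV X⟩

theorem lieS_projΓ (X : L) : A.lieS (A.projΓ X) = 0 := by simp [projΓ_apply]
@[simp] theorem lieS_projV (X : L) : A.lieS (A.projV X) = A.projV X :=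
  (A.isVert_projV X).lieS_eq
@[simp] theorem lieS_projH (X : L) : A.lieS (A.projH X) = -A.projH X := by
  rw [projH_apply, map_real_smul]; simp only [map_sub, map_smul, lieS_Γ, lieS_lieS]; module

variable {A} in
theorem IsVert.projV_eq {X : L} (hX : A.IsVert X) : A.projV X = X := by
  rw [projV_apply, hX.lieS_eq, hX.1, zero_smul]
  module

variable {A} in
theorem IsVert.projH_eq {X : L} (hX : A.IsVert X) : A.projH X = 0 := by
  rw [projH_apply, hX.lieS_eq, hX.1, zero_smul]; module

@[simp] theorem projV_projV (X : L) : A.projV (A.projV X) = A.projV X :=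
  (A.isVert_projV X).projV_eq
@[simp] theorem projH_projV (X : L) : A.projH (A.projV X) = 0 := (A.isVert_projV X).projH_eq
@[simp] theorem projV_S (X : L) : A.projV (A.S X) = A.S X := (isVert_S X).projV_eq
@[simp] theorem projH_S (X : L) : A.projH (A.S X) = 0 := (isVert_S X).projH_eq
@[simp] theorem projΓ_projH (X : L) : A.projΓ (A.projH X) = 0 := A.projΓ_eq_zero (A.dt_projH X)
@[simp] theorem projV_projΓ (X : L) : A.projV (A.projΓ X) = 0 := by simp [projΓ_apply]
@[simp] theorem projH_projH (X : L) : A.projH (A.projH X) = A.projH X := by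
  rw [projH_apply A (A.projH X), lieS_projH, dt_projH, zero_smul]
  module
@[simp] theorem projV_projH (X : L) : A.projV (A.projH X) = 0 := by
  rw [projV_apply A (A.projH X), lieS_projH, dt_projH, zero_smul]; module

theorem proj_sum_of_dt {X : L} (hX : A.dt X = 0) : A.projH X + A.projV X = X := by
  have h := A.proj_sum X
  rwa [A.projΓ_eq_zero hX, zero_add] at h

theorem lieS_eq (X : L) : A.lieS X = A.projV X - A.projH X := by
  rw [projV_apply, projH_apply]
  match_scalars
  · linear_combination -algebraMap_half_mul_two (R := R)
  · ring
  · ring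

/-- The definition of `L_Γ S` combined with `L_Γ S = P_V - P_H`: the rule for moving `S` out of a
bracket with `Γ`. -/
theorem lie_Γ_S (X : L) : ⁅A.Γ, A.S X⁆ = A.S ⁅A.Γ, X⁆ + A.projV X - A.projH X := by
  have h := A.lieS_apply X
  rw [lieS_eq] at h
  linear_combination (norm := module) -h

/-- The tensor `Q`. -/
def Q : L →ₗ[R] L where
  toFun X := -A.projH ⁅A.Γ, A.projV X⁆
  map_add' X Y := by simp; abel
  map_smul' f X := by
    -- The derivative term `Γ(f) P_V X` is vertical, so `P_H` removes it.
    simp only [map_smul, A.lie_smul', map_add, RingHom.id_apply, projH_projV]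
    module

theorem Q_apply (X : L) : A.Q X = -A.projH ⁅A.Γ, A.projV X⁆ := rfl

@[simp] theorem projH_Q (X : L) : A.projH (A.Q X) = A.Q X := by simp [Q_apply]
@[simp] theorem projV_Q (X : L) : A.projV (A.Q X) = 0 := by simp [Q_apply]
@[simp] theorem dt_Q (X : L) : A.dt (A.Q X) = 0 := by simp [Q_apply]
@[simp] theorem Q_Γ : A.Q A.Γ = 0 := by simp [Q_apply]
@[simp] theorem Q_projH (X : L) : A.Q (A.projH X) = 0 := by simp [Q_apply]
@[simp] theorem Q_projV (X : L) : A.Q (A.projV X) = A.Q X := by simp [Q_apply]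
@[simp] theorem Q_Q (X : L) : A.Q (A.Q X) = 0 := by rw [← A.projH_Q X, Q_projH]
@[simp] theorem Q_S (X : L) : A.Q (A.S X) = A.projH X := by
  rw [Q_apply, projV_S, lie_Γ_S]; simp
@[simp] theorem S_Q (X : L) : A.S (A.Q X) = A.projV X := by
  rw [Q_apply, map_neg, S_projH, (A.isVert_projV X).S_lie_Γ, neg_neg]

/-- Differentiating the vanishing of the Nijenhuis bracket of `S` along `Γ`. -/
theorem projV_lie_S_add {X Y : L} (hX : A.projH X = X) (hY : A.projH Y = Y) :
    A.projV ⁅A.S X, Y⁆ + A.projV ⁅X, A.S Y⁆ = A.S ⁅X, Y⁆ := by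
  have hX0 : A.dt X = 0 := by rw [← hX, dt_projH]
  have hY0 : A.dt Y = 0 := by rw [← hY, dt_projH]
  have key {Z : L} (hZ : A.projH Z = Z) : ⁅A.Γ, A.S Z⁆ = A.S ⁅A.Γ, Z⁆ - Z := by
    rw [lie_Γ_S, hZ, ← hZ, projV_projH]; abel
  set W := ⁅A.S X, Y⁆ + ⁅X, A.S Y⁆ with hW
  have hW0 : A.dt W = 0 := by simp [W, A.dt_lie, hX0, hY0]
  have dtΓ {Z : L} (hZ : A.dt Z = 0) : A.dt ⁅A.Γ, Z⁆ = 0 := by simp [A.dt_lie, hZ]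
  have h1 : ⁅A.S X, A.S Y⁆ = A.S W := by rw [A.lie_S_S hX0 hY0, hW, map_add]
  -- On the left, `[Γ, S X] = S[Γ, X] - X` and its analogue for `Y` contribute `-W`. On the right,
  -- `S[Γ, W]` contributes `-2 S[X, Y]`, and `L_Γ S` contributes `P_V W - P_H W`. The other terms
  -- agree, so `W = P_H W + P_V W` leaves `2 P_V W = 2 S[X, Y]`.
  have h2 := congrArg (fun Z => ⁅A.Γ, Z⁆) h1
  simp only [A.lie_Γ_S W] at h2
  rw [leibniz_lie, key hX, key hY, sub_lie, lie_sub, A.lie_S_S (dtΓ hX0) hY0,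
    A.lie_S_S hX0 (dtΓ hY0)] at h2
  have h3 : ⁅A.Γ, W⁆ = ⁅A.S ⁅A.Γ, X⁆, Y⁆ - ⁅X, Y⁆ + ⁅A.S X, ⁅A.Γ, Y⁆⁆ + ⁅⁅A.Γ, X⁆, A.S Y⁆
      + ⁅X, A.S ⁅A.Γ, Y⁆⁆ - ⁅X, Y⁆ := by
    rw [hW, lie_add, leibniz_lie A.Γ (A.S X) Y, leibniz_lie A.Γ X (A.S Y), key hX, key hY,
      sub_lie, lie_sub]
    abel
  rw [h3] at h2
  simp only [map_add, map_sub] at h2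
  have h4 := A.proj_sum_of_dt hW0
  have h5 : A.projV W = A.S ⁅X, Y⁆ := by
    have : (2 : ℝ) • A.projV W = (2 : ℝ) • A.S ⁅X, Y⁆ := by
      linear_combination (norm := module) -h2 + h4 - hW
    simpa using this
  rw [← h5, hW, map_add]

/-- Vertical fields have the form `S(Q X)`, and by `lie_S_S` a bracket of two of these lies in the
image of `S`. -/
theorem isVert_lie {X Y : L} (hX : A.IsVert X) (hY : A.IsVert Y) : A.IsVert ⁅X, Y⁆ := by
  have h := A.lie_S_S (A.dt_Q X) (A.dt_Q Y)
  rw [S_Q, S_Q, hX.projV_eq, hY.projV_eq, ← map_add] at h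
  rw [h]
  exact isVert_S _

end SecondOrderStructure
end

/-! ### The Massa-Pagani connection: existence of the required properties and uniqueness. -/

noncomputable section

namespace SecondOrderStructure

variable {R L : Type*} [CommRing R] [Algebra ℝ R] [LieRing L] [Module ℝ L]
    [Module R L] [IsScalarTower ℝ R L] (A : SecondOrderStructure R L)

/-- The Massa-Pagani connection. -/
def conn (X Y : L) : L :=
  A.anchor X (A.dt Y) • A.Γ
    + (A.Q ⁅A.projH X, A.S Y⁆ + A.projH ⁅X - A.projH X, A.projH Y⁆)
    + (A.S ⁅A.projV X, A.Q Y⁆ + A.projV ⁅X - A.projV X, A.projV Y⁆)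

theorem conn_add_left (X X' Y : L) : A.conn (X + X') Y = A.conn X Y + A.conn X' Y := by
  simp only [conn, map_add, map_sub, Derivation.add_apply, add_lie, sub_lie]
  module

theorem conn_add_right (X Y Y' : L) : A.conn X (Y + Y') = A.conn X Y + A.conn X Y' := by
  simp only [conn, map_add, lie_add]
  module

/-- Each derivative of `f` multiplies a field killed by the outer operator: `Q P_H = 0`, `S P_V =
0`, and `P_H`, `P_V` kill `X - P_H X`, `X - P_V X`. -/
theorem conn_smul_left (f : R) (X Y : L) : A.conn (f • X) Y = f • A.conn X Y := by
  simp only [conn, map_smul, ← smul_sub, A.smul_lie', map_sub, Derivation.smul_apply, Q_projH,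
    projH_projH, S_projV, projV_projV]
  module

/-- With `Q S = P_H`, the derivatives of `f` along `P_H X` and `X - P_H X` add up to `X(f) P_H Y`.
The vertical part works likewise with `S Q = P_V`, and the three parts sum to `X(f) Y`. -/
theorem conn_leibniz (f : R) (X Y : L) :
    A.conn X (f • Y) = A.anchor X f • Y + f • A.conn X Y := by
  simp only [conn, map_smul, A.lie_smul', map_add, Q_S, S_Q, projH_projH, projV_projV,
    smul_eq_mul, Derivation.leibniz]
  have h := A.proj_sum Y
  rw [projΓ_apply] at h
  have h1 := congrArg (fun Z => A.anchor X f • Z) h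
  simp only [map_sub, sub_lie, smul_add, smul_sub, sub_smul, Derivation.sub_apply] at h1 ⊢
  linear_combination (norm := module) h1

theorem conn_Γ (X : L) : A.conn X A.Γ = 0 := by
  simp [conn]

theorem dt_conn (X Y : L) : A.dt (A.conn X Y) = A.anchor X (A.dt Y) := by
  simp [conn]

theorem S_conn (X Y : L) :
    A.S (A.conn X Y) =
      A.projV ⁅A.projH X, A.S Y⁆ + A.S ⁅X - A.projH X, A.projH Y⁆ := by
  simp [conn]

theorem Q_conn (X Y : L) :
    A.Q (A.conn X Y) =
      A.projH ⁅A.projV X, A.Q Y⁆ + A.Q ⁅X - A.projV X, A.projV Y⁆ := by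
  simp [conn]

theorem projV_lie_Γ_S (X : L) : A.projV ⁅A.Γ, A.S X⁆ = A.S ⁅A.Γ, X⁆ + A.projV X := by
  rw [lie_Γ_S]; simp

theorem Q_lie_Γ_S (X : L) : A.Q ⁅A.Γ, A.S X⁆ = A.projH ⁅A.Γ, X⁆ + A.Q X := by
  rw [lie_Γ_S]; simp

/-- The two sides match term by term except for the `Γ` component of `X`, where `P_V[Γ, S Y] = S[Γ,
P_H Y]` is needed (`h3`). -/
theorem conn_S (X Y : L) : A.conn X (A.S Y) = A.S (A.conn X Y) := by
  have hX := A.proj_sum X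
  have h1 : X - A.projH X = A.projΓ X + A.projV X := by
    linear_combination (norm := module) -hX
  have h2 : X - A.projV X = A.projΓ X + A.projH X := by
    linear_combination (norm := module) -hX
  have h3 : A.projV ⁅A.projΓ X, A.S Y⁆ = A.S ⁅A.projΓ X, A.projH Y⁆ := by
    have h := A.projV_lie_Γ_S (A.projH Y)
    rw [S_projH, projV_projH, add_zero] at h
    rw [projΓ_apply, A.smul_lie', A.smul_lie']
    simp [h]
  rw [S_conn, conn, h1, h2]
  simp [add_lie, h3]
  abel

theorem conn_Q (X Y : L) : A.conn X (A.Q Y) = A.Q (A.conn X Y) := by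
  have hX := A.proj_sum X
  have h1 : X - A.projH X = A.projΓ X + A.projV X := by
    linear_combination (norm := module) -hX
  have h2 : X - A.projV X = A.projΓ X + A.projH X := by
    linear_combination (norm := module) -hX
  have h3 : A.projH ⁅A.projΓ X, A.Q Y⁆ = A.Q ⁅A.projΓ X, A.projV Y⁆ := by
    have h := A.Q_lie_Γ_S (A.Q Y)
    rw [S_Q, Q_Q, add_zero] at h
    rw [projΓ_apply, A.smul_lie', A.smul_lie']
    simp [h]
  rw [Q_conn, conn, h1, h2]
  simp [add_lie, h3]
  abel

theorem conn_Γ_left (Y : L) :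
    A.conn A.Γ Y = A.anchor A.Γ (A.dt Y) • A.Γ + A.projH ⁅A.Γ, A.projH Y⁆
      + A.projV ⁅A.Γ, A.projV Y⁆ := by
  simp [conn]

variable {A}

theorem IsVert.conn_vert {V Y : L} (hV : A.IsVert V) (hY : A.IsVert Y) :
    A.conn V Y = A.S ⁅V, A.Q Y⁆ := by
  simp [conn, hV.projV_eq, hV.projH_eq, hY.projH_eq, hY.1, hY.2]

/-- Here `∇_V U = S[V, Q U]`. Since `V = S(Q V)` and `U = S(Q U)`, `lie_S_S` gives `[V, U] = S[V, Q
U] + S[Q V, U]`, and `lie_lift` identifies the last term with `[V, U]`. -/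
theorem conn_lift {V U : L} (hV : A.IsVert V) (hU : A.IsLift U) : A.conn V U = 0 := by
  have hU' : A.IsVert U := by
    refine ⟨A.lift_time U hU, A.eq_of_anchor (by simp) ?_ ?_⟩
    · intro f hf; simp [A.anchor_S_base _ f hf]
    · intro f hf
      rw [A.anchor_S_velocity _ f hf, A.lift_time U hU, A.lift_base U hU f hf]; simp
  rw [hV.conn_vert hU']
  have h := A.lie_S_S (A.dt_Q V) (A.dt_Q U)
  rw [S_Q, S_Q, hV.projV_eq, hU'.projV_eq, A.lie_lift hU (A.dt_Q V), S_Q, hV.projV_eq] at h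
  simpa using h

variable (A)

/-- The curvature of a connection. -/
def curv (D : L → L → L) (X Y Z : L) : L := D X (D Y Z) - D Y (D X Z) - D ⁅X, Y⁆ Z

/-- The torsion of a connection. -/
def tors (D : L → L → L) (X Y : L) : L := D X Y - D Y X - ⁅X, Y⁆

theorem tors_Γ_S (X : L) : tors A.conn A.Γ (A.S X) = A.projH X := by
  rw [tors, conn_Γ, conn_Γ_left]
  simp only [dt_S, map_zero, zero_smul, projH_S, lie_zero, projV_S, projV_lie_Γ_S]
  rw [lie_Γ_S]
  abel

theorem S_tors_Γ (X : L) : A.S (tors A.conn A.Γ X) = A.projV X := by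
  have h := A.projV_lie_Γ_S X
  rw [tors, conn_Γ, sub_zero, map_sub, ← conn_S, conn_Γ_left]
  simp [h]

/-- The mixed curvature vanishes on horizontal and vertical arguments because of the Jacobi
identity and `projV_lie_S_add`. -/
theorem curv_vert {V Y : L} (hV : A.IsVert V) (hY : A.IsVert Y) :
    curv A.conn A.Γ V Y = 0 := by
  have hVY : A.IsVert (A.conn V Y) := by rw [hV.conn_vert hY]; exact isVert_S _
  have hΓ {W : L} (hW : A.IsVert W) : A.conn A.Γ W = A.projV ⁅A.Γ, W⁆ := by
    rw [conn_Γ_left, hW.projV_eq, hW.projH_eq, hW.1]; simp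
  set Z := A.Q Y with hZ
  have hSZ : A.S Z = Y := by rw [hZ, S_Q, hY.projV_eq]
  have hPZ : A.projH Z = Z := A.projH_Q Y
  have hdt : A.dt ⁅A.Γ, V⁆ = 0 := by simp [A.dt_lie, hV.1]
  have hPV : A.projV ⁅A.Γ, V⁆ = ⁅A.Γ, V⁆ + A.Q V := by
    have h1 := A.proj_sum_of_dt hdt
    have h2 := A.Q_apply V
    rw [hV.projV_eq] at h2
    linear_combination (norm := module) h1 - h2
  have hPH : A.projH ⁅A.Γ, V⁆ = -A.Q V := by
    rw [Q_apply, hV.projV_eq, neg_neg]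
  have e1 : A.conn A.Γ (A.conn V Y) = A.S ⁅A.Γ, ⁅V, Z⁆⁆ + A.projV ⁅V, Z⁆ := by
    rw [hΓ hVY, hV.conn_vert hY, projV_lie_Γ_S]
  have e2 : A.conn V (A.conn A.Γ Y) = A.S ⁅V, ⁅A.Γ, Z⁆⁆ := by
    -- `Q P_V[Γ, Y]` becomes `P_H[Γ, Z]`; its difference from `[Γ, Z]` is vertical, so it
    -- contributes a vertical bracket, which `S` kills.
    rw [hΓ hY, hV.conn_vert (A.isVert_projV _), Q_projV, ← hSZ, Q_lie_Γ_S, hZ, Q_Q, add_zero,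
      ← hZ]
    have hd : A.dt ⁅A.Γ, Z⁆ = 0 := by simp [A.dt_lie, hZ]
    have h1 := A.proj_sum_of_dt hd
    have h2 := (A.isVert_lie hV (A.isVert_projV ⁅A.Γ, Z⁆)).2
    have h3 := congrArg (fun W => A.S ⁅V, W⁆) h1
    simp only [lie_add, map_add, h2, add_zero] at h3
    exact h3
  have e3 : A.conn ⁅A.Γ, V⁆ Y = A.S ⁅⁅A.Γ, V⁆, Z⁆ + A.S ⁅A.Q V, Z⁆ - A.projV ⁅A.Q V, Y⁆ := by
    rw [conn, hY.1, hY.2, hY.projH_eq, hY.projV_eq, hPV]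
    simp only [map_zero, zero_smul, lie_zero, add_zero, zero_add, add_lie, map_add, ← hZ,
      sub_add_cancel_left, neg_lie, map_neg]
    abel
  -- After the Jacobi identity the curvature is `P_V[V, Z] + P_V[Q V, Y] - S[Q V, Z]`, which is this
  -- identity for the horizontal fields `Q V` and `Z`.
  have key := A.projV_lie_S_add (A.projH_Q V) hPZ
  rw [S_Q, hV.projV_eq, hSZ] at key
  rw [curv, e1, e2, e3, leibniz_lie A.Γ V Z, map_add]
  linear_combination (norm := module) key

theorem curv_Γ_vert {V : L} (hV : A.IsVert V) (Z : L) : curv A.conn A.Γ V Z = 0 := by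
  have hadd (Z Z' : L) : curv A.conn A.Γ V (Z + Z') =
      curv A.conn A.Γ V Z + curv A.conn A.Γ V Z' := by
    simp only [curv, conn_add_right]; abel
  -- `P_H Z = Q(S Z)`, and the curvature commutes with `Q` because the connection does.
  have hQ : curv A.conn A.Γ V (A.projH Z) = 0 := by
    have h := A.curv_vert hV (isVert_S Z)
    have h2 := congrArg A.Q h
    rw [← A.Q_S]
    simpa only [curv, map_sub, ← conn_Q, map_zero] using h2
  have hΓ' (X : L) : A.conn X (A.projΓ Z) = A.anchor X (A.dt Z) • A.Γ := by
    rw [projΓ_apply, conn_leibniz, conn_Γ]; simp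
  have hG : curv A.conn A.Γ V (A.projΓ Z) = 0 := by
    simp only [curv, hΓ', conn_leibniz, conn_Γ, A.anchor_lie]
    module
  rw [← A.proj_sum Z, hadd, hadd, hG, hQ, A.curv_vert hV (A.isVert_projV Z)]
  simp

section Uniqueness

variable {A} {D : L → L → L}

/-- The conditions characterizing the Massa-Pagani connection. -/
theorem eq_conn (add_left : ∀ X X' Y, D (X + X') Y = D X Y + D X' Y)
    (smul_left : ∀ (f : R) X Y, D (f • X) Y = f • D X Y)
    (add_right : ∀ X Y Y', D X (Y + Y') = D X Y + D X Y')
    (leibniz : ∀ (f : R) X Y, D X (f • Y) = A.anchor X f • Y + f • D X Y)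
    (hDΓ : ∀ X, D X A.Γ = 0)
    (hDQ : ∀ X Y, D X (A.Q Y) = A.Q (D X Y))
    (htors : ∀ X, tors D A.Γ (A.S X) = A.projH X)
    (hcurv : ∀ V, A.IsVert V → ∀ Z, curv D A.Γ V Z = 0)
    (hlift : ∀ V U, A.IsVert V → A.IsLift U → D V U = 0) : D = A.conn := by
  -- `Γ` is parallel, `P_H Y = Q(S Y)` and `P_V Y = S(Q Y)`, so values on the image of `S` suffice.
  have reduce (X : L) (h : ∀ Y, D X (A.S Y) = A.conn X (A.S Y)) (Y : L) : D X Y = A.conn X Y := by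
    rw [← A.proj_sum Y, add_right, add_right, conn_add_right, conn_add_right]
    congr 1
    · congr 1
      · rw [projΓ_apply, leibniz, conn_leibniz, hDΓ, conn_Γ]
      · rw [← A.Q_S, hDQ, conn_Q, h]
    · rw [← A.S_Q, h]
  have hΓ (Y : L) : D A.Γ Y = A.conn A.Γ Y := by
    refine reduce _ (fun Y => ?_) Y
    have h := (htors Y).trans (A.tors_Γ_S Y).symm
    rw [tors, tors, hDΓ, conn_Γ] at h
    simpa using h
  have hV (V : L) (hV : A.IsVert V) (Y : L) : D V Y = A.conn V Y := by
    refine reduce _ (fun Y => ?_) Y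
    -- The difference of two connections is tensorial in `Y`, so agreement on lifts extends to all
    -- vertical fields.
    let δ : L →ₗ[R] L :=
      { toFun := fun Y => D V Y - A.conn V Y
        map_add' := fun Y Y' => by rw [add_right, conn_add_right]; abel
        map_smul' := fun f Y => by rw [leibniz, conn_leibniz, RingHom.id_apply]; module }
    exact sub_eq_zero.1 (A.lift_span δ
      (fun U hU => by simp [δ, hlift V U hV hU, conn_lift hV hU]) Y)
  have hlie (V : L) (hV' : A.IsVert V) (Y : L) : D ⁅A.Γ, V⁆ Y = A.conn ⁅A.Γ, V⁆ Y := by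
    have h := (hcurv V hV' Y).trans (A.curv_Γ_vert hV' Y).symm
    rw [curv, curv, hV V hV', hV V hV', hΓ, hΓ] at h
    simpa using h
  funext X Y
  -- Every direction is a combination of `Γ`, vertical fields and one bracket `[Γ, S X]`, whose
  -- horizontal part is `-P_H X`.
  have hX : X = A.dt X • A.Γ + (A.projV X + A.projV ⁅A.Γ, A.S X⁆) - ⁅A.Γ, A.S X⁆ := by
    have h1 := A.proj_sum X
    have h2 : A.dt ⁅A.Γ, A.S X⁆ = 0 := by simp [A.dt_lie]
    have h3 := A.proj_sum_of_dt h2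
    have h4 : A.projH ⁅A.Γ, A.S X⁆ = -A.projH X := by rw [lie_Γ_S]; simp
    rw [projΓ_apply] at h1
    linear_combination (norm := module) -h1 - h3 + h4
  have hsub {E : L → L → L} (h : ∀ X X' Y, E (X + X') Y = E X Y + E X' Y) (X X' Y : L) :
      E (X - X') Y = E X Y - E X' Y := by
    rw [eq_sub_iff_add_eq, ← h, sub_add_cancel]
  rw [hX, hsub add_left, hsub A.conn_add_left, add_left, conn_add_left, add_left, conn_add_left,
    smul_left, conn_smul_left, hΓ, hV _ (A.isVert_projV _), hV _ (A.isVert_projV _),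
    hlie _ (isVert_S X)]

end Uniqueness

end SecondOrderStructure
end

/-! ### Vector fields on the evolution space as a Lie ring acting by derivations. -/

noncomputable section

namespace Evolution

variable {F M : Type*} [NormedAddCommGroup F] [NormedSpace ℝ F]
  [TopologicalSpace M] [ChartedSpace F M] [IsManifold 𝓘(ℝ, F) ∞ M]

theorem lieDeriv_apply (X : VField F M) (f : Fun F M) (p : Space F M) :
    lieDeriv X f p = mvfderiv (model F) f p (X p) := rfl

theorem mdifferentiableAt_fun (f : Fun F M) (p : Space F M) :
    MDifferentiableAt (model F) 𝓘(ℝ, ℝ) f p := f.contMDiff.mdifferentiable (by simp) p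

theorem mdifferentiableAt_field (X : VField F M) (p : Space F M) :
    MDifferentiableAt (model F) (model F).tangent
      (fun q => (⟨q, X q⟩ : TangentBundle (model F) (Space F M))) p :=
  X.mdifferentiableAt

instance : Module (Fun F M) (VField F M) where
  smul := mulField
  one_smul X := by ext p; exact one_smul ℝ (X p)
  mul_smul f g X := by ext p; exact mul_smul (f p) (g p) (X p)
  smul_zero f := by ext p; exact smul_zero (f p)
  smul_add f X Y := by ext p; exact smul_add (f p) (X p) (Y p)
  add_smul f g X := by ext p; exact add_smul (f p) (g p) (X p)
  zero_smul X := by ext p; exact zero_smul ℝ (X p)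

theorem smul_apply (f : Fun F M) (X : VField F M) (p : Space F M) : (f • X) p = f p • X p := rfl

instance : IsScalarTower ℝ (Fun F M) (VField F M) where
  smul_assoc c f X := by ext p; exact mul_smul c (f p) (X p)

/-- Vector fields act on functions as derivations. -/
def anchor : VField F M →ₗ[Fun F M] Derivation ℝ (Fun F M) (Fun F M) where
  toFun X :=
    { toFun := lieDeriv X
      map_add' := fun f g => by
        ext p
        have h := mvfderiv_add (mdifferentiableAt_fun f p) (mdifferentiableAt_fun g p)
        exact congrArg (fun φ => φ (X p)) h
      map_smul' := fun c f => by
        ext p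
        have h := mvfderiv_smul (I := model F) (x := p) (a := fun _ => c) mdifferentiableAt_const
          (mdifferentiableAt_fun f p)
        rw [mvfderiv_const] at h
        refine (congrArg (fun φ => φ (X p)) h).trans ?_
        simp [lieDeriv_apply]
      map_one_eq_zero' := by
        ext p
        exact congrArg (fun φ => φ (X p)) (mvfderiv_const (I := model F) (x := p) (1 : ℝ))
      leibniz' := fun f g => by
        ext p
        have h := mvfderiv_mul (mdifferentiableAt_fun f p) (mdifferentiableAt_fun g p)
        exact congrArg (fun φ => φ (X p)) h }
  map_add' X Y := by
    ext f p
    exact map_add (mvfderiv (model F) f p) (X p) (Y p)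
  map_smul' g X := by
    ext f p
    exact map_smul (mvfderiv (model F) f p) (g p) (X p)

variable [FiniteDimensional ℝ F]

instance : LieRing (VField F M) where
  bracket := bracket
  add_lie X Y Z := by
    ext p
    exact VectorField.mlieBracket_add_left (mdifferentiableAt_field X p)
      (mdifferentiableAt_field Y p)
  lie_add X Y Z := by
    ext p
    exact VectorField.mlieBracket_add_right (mdifferentiableAt_field Y p)
      (mdifferentiableAt_field Z p)
  lie_self X := by
    ext p
    have h := VectorField.mlieBracket_swap_apply (I := model F) (V := X) (W := X) (x := p)
    have h2 : (2 : ℝ) • (VectorField.mlieBracket (model F) X X p : TSpace p) = 0 := by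
      rw [two_smul]; exact eq_neg_iff_add_eq_zero.1 h
    exact (smul_eq_zero.1 h2).resolve_left two_ne_zero
  leibniz_lie X Y Z := by
    ext p
    have hs (W : VField F M) : ContMDiffAt (model F) (model F).tangent (minSmoothness ℝ 2)
        (fun q => (⟨q, W q⟩ : TangentBundle (model F) (Space F M))) p := by
      exact (W.contMDiff p).of_le (by
        rw [minSmoothness_of_isRCLikeNormedField]; exact ENat.LEInfty.out)
    have : IsManifold (model F) 3 (Space F M) :=
      IsManifold.of_le (n := ∞) ENat.LEInfty.out
    have : IsManifold (model F) (minSmoothness ℝ 3) (Space F M) := by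
      rw [minSmoothness_of_isRCLikeNormedField]; exact this
    exact VectorField.leibniz_identity_mlieBracket_apply (hs X) (hs Y) (hs Z)

theorem bracket_eq_lie (X Y : VField F M) : bracket X Y = ⁅X, Y⁆ := rfl

theorem curvature_eq_curv (D : VField F M → VField F M → VField F M) (X Y Z : VField F M) :
    curvature D X Y Z = SecondOrderStructure.curv D X Y Z := rfl

theorem torsion_eq_tors (D : VField F M → VField F M → VField F M) (X Y : VField F M) :
    torsion D X Y = SecondOrderStructure.tors D X Y := rfl

theorem lie_smul_field (X : VField F M) (f : Fun F M) (Y : VField F M) :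
    ⁅X, f • Y⁆ = anchor X f • Y + f • ⁅X, Y⁆ := by
  ext p
  exact VectorField.mlieBracket_smul_right (mdifferentiableAt_fun f p) (mdifferentiableAt_field Y p)

/-- The commutator formula follows from the Jacobi identity, once some vector field `Z` and some
function `t` satisfy `Z t = 1`. -/
theorem anchor_lie {Z : VField F M} {t : Fun F M} (hZ : anchor Z t = 1) (X Y : VField F M)
    (f : Fun F M) : anchor ⁅X, Y⁆ f = anchor X (anchor Y f) - anchor Y (anchor X f) := by
  have h := leibniz_lie X Y (f • Z)
  simp only [lie_smul_field, lie_add] at h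
  rw [leibniz_lie X Y Z] at h
  have h' : anchor ⁅X, Y⁆ f • Z = (anchor X (anchor Y f) - anchor Y (anchor X f)) • Z := by
    linear_combination (norm := module) -h
  have h2 := congrArg (fun W => anchor W t) h'
  simpa [hZ] using h2

end Evolution
end

/-! ### Derivatives along vertical lifts, and vertical tangent vectors. -/

noncomputable section

namespace Evolution

variable {F M : Type*} [NormedAddCommGroup F] [NormedSpace ℝ F]
  [TopologicalSpace M] [ChartedSpace F M] [IsManifold 𝓘(ℝ, F) ∞ M]

variable (F M) in
/-- Smooth real functions on `M`. -/
abbrev BaseFun : Type _ := ContMDiffMap 𝓘(ℝ, F) 𝓘(ℝ, ℝ) M ℝ ∞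

theorem contMDiff_base : ContMDiff (model F) 𝓘(ℝ, F) ∞ (fun q : Space F M => q.2.proj) :=
  (Bundle.contMDiff_proj (TangentSpace 𝓘(ℝ, F) : M → Type _)).comp contMDiff_snd

/-- The pullback of a function on `M` to the evolution space. -/
def pullback (f : BaseFun F M) : Fun F M :=
  ⟨fun q => f q.2.proj, f.contMDiff.comp contMDiff_base⟩

/-- The differential of a function on `M`. -/
abbrev diff (f : BaseFun F M) (x : M) : TangentSpace 𝓘(ℝ, F) x →L[ℝ] ℝ := mvfderiv 𝓘(ℝ, F) f x

theorem mvfderiv_pullback (f : BaseFun F M) (p : Space F M) (ξ : TSpace p) :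
    mvfderiv (model F) (pullback f) p ξ = diff f p.2.proj (dbase p ξ) :=
  mvfderiv_comp_apply (I := 𝓘(ℝ, F)) p (f.contMDiff.mdifferentiable (by simp) p.2.proj)
    (contMDiff_base.mdifferentiable (by simp) p) ξ

theorem mvfderiv_vlift (g : Fun F M) (p : Space F M) (w : BaseTSpace p) :
    mvfderiv (model F) g p (vlift p w) =
      fderiv ℝ (fun v : F => g ((p.1, ⟨p.2.proj, v⟩) : Space F M)) p.2.snd w := by
  have h := mvfderiv_comp_apply (I := model F) (I' := 𝓘(ℝ, F))
    (f := fun v : F => ((p.1, ⟨p.2.proj, v⟩) : Space F M)) (g := g)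
    (p.2.snd : F) (mdifferentiableAt_fun g p)
    ((contMDiff_fibre p).mdifferentiable (by simp) p.2.snd) w
  refine h.symm.trans ?_
  exact congrArg (fun L : F →L[ℝ] ℝ => L w) (mfderiv_eq_fderiv (𝕜 := ℝ)
    (f := fun v : F => g ((p.1, ⟨p.2.proj, v⟩) : Space F M)) (x := (p.2.snd : F)))

theorem dtAt_vlift (p : Space F M) (w : BaseTSpace p) : dtAt p (vlift p w) = 0 := by
  refine (mvfderiv_vlift timeFun p w).trans ?_
  simp [timeFun]
  rfl

theorem mvfderiv_pullback_vlift (f : BaseFun F M) (p : Space F M) (w : BaseTSpace p) :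
    mvfderiv (model F) (pullback f) p (vlift p w) = 0 := by
  refine (mvfderiv_vlift (pullback f) p w).trans ?_
  simp [pullback]
  rfl

theorem dbase_vlift (p : Space F M) (w : BaseTSpace p) : dbase p (vlift p w) = 0 := by
  have h := mfderiv_comp (I := 𝓘(ℝ, F)) (I' := model F) (I'' := 𝓘(ℝ, F))
    (f := fun v : F => ((p.1, ⟨p.2.proj, v⟩) : Space F M)) (g := fun q : Space F M => q.2.proj) (p.2.snd : F)
    (contMDiff_base.mdifferentiable (by simp) p)
    ((contMDiff_fibre p).mdifferentiable (by simp) p.2.snd)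
  have h2 : mfderiv 𝓘(ℝ, F) 𝓘(ℝ, F) (fun _ : F => p.2.proj) (p.2.snd : F) = 0 := mfderiv_const
  exact (congrArg (fun L : F →L[ℝ] F => L w) (h.symm.trans h2))

theorem IsSODE.anchor_timeFun {Γ : VField F M} (hΓ : IsSODE Γ) : anchor Γ timeFun = 1 := by
  ext p; exact hΓ.dt_eq_one p

theorem IsSODE.dbase_eq {Γ : VField F M} (hΓ : IsSODE Γ) (p : Space F M) :
    dbase p (Γ p) = p.2.snd := by
  have h := hΓ.contact_eq_zero p
  rwa [contactAt, hΓ.dt_eq_one, one_smul, sub_eq_zero] at h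

theorem IsSODE.velocity_apply {Γ : VField F M} (hΓ : IsSODE Γ) (f : BaseFun F M) (p : Space F M) :
    anchor Γ (pullback f) p = diff f p.2.proj p.2.snd := by
  rw [← hΓ.dbase_eq, ← mvfderiv_pullback]
  rfl

/-- On each fibre `Γ f` is the linear function `v ↦ df(v)`, which is its own derivative. -/
theorem IsSODE.mvfderiv_velocity_vlift {Γ : VField F M} (hΓ : IsSODE Γ) (f : BaseFun F M)
    (p : Space F M) (w : BaseTSpace p) :
    mvfderiv (model F) (anchor Γ (pullback f)) p (vlift p w) = diff f p.2.proj w := by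
  rw [mvfderiv_vlift]
  have h : (fun v : F => anchor Γ (pullback f) ((p.1, ⟨p.2.proj, v⟩) : Space F M)) =
      fun v : F => (diff f p.2.proj : F →L[ℝ] ℝ) v := by
    funext v
    exact hΓ.velocity_apply f _
  rw [h]
  exact congrArg (fun L : F →L[ℝ] ℝ => L w) (diff f p.2.proj : F →L[ℝ] ℝ).fderiv

theorem contactAt_add (p : Space F M) (ξ η : TSpace p) :
    contactAt p (ξ + η) = contactAt p ξ + contactAt p η := by
  simp only [contactAt, map_add]; module

theorem contactAt_smul (p : Space F M) (c : ℝ) (ξ : TSpace p) :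
    contactAt p (c • ξ) = c • contactAt p ξ := by
  simp only [contactAt, map_smul, smul_sub, smul_smul, smul_eq_mul]

/-- The vertical endomorphism as a linear map. -/
def vertEndoₗ : VField F M →ₗ[Fun F M] VField F M where
  toFun := vertEndo
  map_add' X Y := by
    ext p
    refine (congrArg (vlift p) (contactAt_add p (X p) (Y p))).trans (map_add _ _ _)
  map_smul' f X := by
    ext p
    refine (congrArg (vlift p) (contactAt_smul p (f p) (X p))).trans (map_smul _ _ _)

open Bundle in
/-- A tangent vector of the evolution space that projects to zero on `ℝ × M` is a vertical lift. -/
theorem exists_vlift_eq (p : Space F M) (ξ : TSpace p) (h1 : dtAt p ξ = 0) (h2 : dbase p ξ = 0) :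
    ∃ w : BaseTSpace p, vlift p w = ξ := by
  let Φ : Space F M → ℝ × (F × F) := extChartAt (model F) p
  let T : TSpace p →L[ℝ] ℝ × (F × F) := mfderiv (model F) 𝓘(ℝ, ℝ × (F × F)) Φ p
  have hΦ : MDifferentiableAt (model F) 𝓘(ℝ, ℝ × (F × F)) Φ p :=
    mdifferentiableAt_extChartAt (mem_chart_source _ p)
  have hT1 : (T ξ).1 = 0 := by
    have h := mvfderiv_comp_apply (I := 𝓘(ℝ, ℝ × (F × F))) (I' := model F)
      (g := fun z : ℝ × (F × F) => z.1) p
      (differentiableAt_fst.mdifferentiableAt) hΦ ξ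
    have h3 : mvfderiv 𝓘(ℝ, ℝ × (F × F)) (fun z : ℝ × (F × F) => z.1) (Φ p) =
        ContinuousLinearMap.fst ℝ ℝ (F × F) := by
      simp only [mvfderiv, mfderiv_eq_fderiv, fderiv_fst]
      rfl
    rw [h3] at h
    exact h.symm.trans h1
  have hT2 : (T ξ).2.1 = 0 := by
    let pr : ℝ × (F × F) →L[ℝ] F :=
      (ContinuousLinearMap.fst ℝ F F).comp (ContinuousLinearMap.snd ℝ ℝ (F × F))
    have h := mfderiv_comp_apply (I' := 𝓘(ℝ, ℝ × (F × F))) (I := model F) (I'' := 𝓘(ℝ, F))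
      (g := pr) p pr.differentiableAt.mdifferentiableAt hΦ ξ
    rw [mfderiv_eq_fderiv, ContinuousLinearMap.fderiv] at h
    have h4 := mfderiv_comp_apply (I' := 𝓘(ℝ, F)) (I := model F) (I'' := 𝓘(ℝ, F))
      (g := extChartAt 𝓘(ℝ, F) p.2.proj) (f := fun q : Space F M => q.2.proj) p
      (mdifferentiableAt_extChartAt (mem_chart_source F p.2.proj))
      (contMDiff_base.mdifferentiable (by simp) p) ξ
    refine h.symm.trans (h4.trans ?_)
    exact (congrArg _ h2).trans (map_zero _)
  have hx : p.2.proj ∈ (trivializationAt F (TangentSpace 𝓘(ℝ, F)) p.2.proj).baseSet :=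
    FiberBundle.mem_baseSet_trivializationAt' p.2.proj
  -- In the chart at `p` only the velocity component of `ξ` survives; `w` is that component read
  -- back through the trivialization.
  let w : BaseTSpace p :=
    (trivializationAt F (TangentSpace 𝓘(ℝ, F)) p.2.proj).symmL ℝ p.2.proj (T ξ).2.2
  refine ⟨w, ?_⟩
  have hinj : Function.Injective T :=
    (isInvertible_mfderiv_extChartAt (I := model F) (mem_extChartAt_source p)).injective
  apply hinj
  refine (mfderiv_chart_vlift p p (mem_chart_source _ p) (mem_chart_source F p.2.proj) w).trans ?_
  rw [triv_eq p.2.proj p.2.proj (mem_chart_source F p.2.proj) w,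
    Trivialization.continuousLinearMapAt_symmL _ hx]
  exact Prod.ext hT1.symm (Prod.ext hT2.symm rfl)

theorem isVertical_iff {X : VField F M} :
    IsVertical X ↔ ∀ p, dtAt p (X p) = 0 ∧ dbase p (X p) = 0 := by
  refine forall_congr' fun p => ?_
  have h := mfderiv_prodMk (I := model F) (I' := 𝓘(ℝ, ℝ)) (I'' := 𝓘(ℝ, F)) (x := p)
    (f := fun q : Space F M => q.1) (g := fun q : Space F M => q.2.proj)
    (contMDiff_fst.mdifferentiable (n := ∞) (by simp) p)
    (contMDiff_base.mdifferentiable (by simp) p)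
  rw [h]
  exact Prod.ext_iff

end Evolution
end

/-! ### Cut-off coordinates and frames: global functions and lifts that suffice locally. -/

noncomputable section

namespace Evolution

variable {F M : Type*} [NormedAddCommGroup F] [NormedSpace ℝ F]
  [TopologicalSpace M] [ChartedSpace F M] [IsManifold 𝓘(ℝ, F) ∞ M]

variable (F M) in
/-- Smooth vector fields on `M`. -/
abbrev BaseField : Type _ := ContMDiffSection 𝓘(ℝ, F) F ∞ (TangentSpace 𝓘(ℝ, F) : M → Type _)

open Bundle in
theorem contMDiff_lift (W : BaseField F M) :
    ContMDiff (model F) ((model F).prod 𝓘(ℝ, ℝ × (F × F))) ∞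
      (fun p : Space F M => TotalSpace.mk' (ℝ × (F × F)) (E := fun p : Space F M => TSpace p) p
        (vlift p (W p.2.proj))) := by
  intro p₀
  refine (contMDiffAt_section p₀).2 ?_
  let e := trivializationAt F (TangentSpace 𝓘(ℝ, F) : M → Type _) p₀.2.proj
  have h1 : ContMDiffAt (model F) 𝓘(ℝ, F) ∞
      (fun p : Space F M => (e ⟨p.2.proj, W p.2.proj⟩).2) p₀ :=
    (contMDiffAt_totalSpace.1 ((W.contMDiff.comp contMDiff_base) p₀)).2
  have h3 : ContMDiffAt (model F) 𝓘(ℝ, ℝ × (F × F)) ∞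
      (fun p : Space F M => (((0 : ℝ), ((0 : F),
        (e ⟨p.2.proj, W p.2.proj⟩).2)) : ℝ × (F × F))) p₀ :=
    ContMDiffAt.prodMk_space contMDiffAt_const (contMDiffAt_const.prodMk_space h1)
  refine h3.congr_of_eventuallyEq ?_
  have hs : ∀ᶠ p in nhds p₀, p ∈ (chartAt (ModelProd ℝ (ModelProd F F)) p₀).source :=
    (chartAt (ModelProd ℝ (ModelProd F F)) p₀).open_source.mem_nhds
      (mem_chart_source (ModelProd ℝ (ModelProd F F)) p₀)
  have hb : ∀ᶠ p in nhds p₀, p.2.proj ∈ (chartAt F p₀.2.proj).source :=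
    contMDiff_base.continuous.continuousAt.eventually
      ((chartAt F p₀.2.proj).open_source.mem_nhds (mem_chart_source F p₀.2.proj))
  filter_upwards [hs, hb] with p hp hx
  have k1 := mfderiv_chart_vlift p₀ p hp hx (W p.2.proj)
  have k2 := TangentBundle.continuousLinearMapAt_trivializationAt (I := model F) hp
  have k3 : (trivializationAt (ℝ × (F × F)) (fun p : Space F M => TSpace p) p₀
      ⟨p, vlift p (W p.2.proj)⟩).2 =
      (trivializationAt (ℝ × (F × F)) (TangentSpace (model F)) p₀).continuousLinearMapAt ℝ p
        (vlift p (W p.2.proj)) := by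
    rw [Trivialization.continuousLinearMapAt_apply, Trivialization.linearMapAt_apply, if_pos]
    exact hp
  rw [k3, k2]
  exact k1

/-- The vertical lift of a vector field on `M`. -/
def liftField (W : BaseField F M) : VField F M := ⟨fun p => vlift p (W p.2.proj), contMDiff_lift W⟩

theorem isVerticalLift_liftField (W : BaseField F M) : IsVerticalLift (liftField W) :=
  ⟨fun q => W q.2, fun _ => rfl⟩

variable [FiniteDimensional ℝ F] [T2Space M]

section Frame

variable {x₀ : M} (χ : SmoothBumpFunction 𝓘(ℝ, F) x₀)

/-- A bump function as a smooth function on `M`. -/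
def bumpFun : BaseFun F M := ⟨χ, χ.contMDiff⟩

/-- The coordinate functions around `x₀`, cut off by a bump function. -/
def coordFun (i : Fin (Module.finrank ℝ F)) : BaseFun F M :=
  ⟨fun x => χ x • (Module.finBasis ℝ F).coord i (extChartAt 𝓘(ℝ, F) x₀ x), by
    refine χ.contMDiff_smul ?_
    have h : ContMDiff 𝓘(ℝ, F) 𝓘(ℝ, ℝ) ∞
        (((Module.finBasis ℝ F).coord i).toContinuousLinearMap : F →L[ℝ] ℝ) :=
      ContinuousLinearMap.contMDiff _
    exact h.comp_contMDiffOn contMDiffOn_extChartAt⟩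

open Bundle in
/-- The coordinate vector fields around `x₀`, cut off by a bump function. -/
def frameField (i : Fin (Module.finrank ℝ F)) : BaseField F M :=
  ⟨fun x => χ x • (trivializationAt F (TangentSpace 𝓘(ℝ, F) : M → Type _) x₀).symmL ℝ x
      (Module.finBasis ℝ F i), by
    let e := trivializationAt F (TangentSpace 𝓘(ℝ, F) : M → Type _) x₀
    refine ContMDiffOn.smul_section_of_tsupport (u := e.baseSet) χ.contMDiff.contMDiffOn
      e.open_baseSet χ.tsupport_subset_chartAt_source ?_
    rw [e.contMDiffOn_section_baseSet_iff]
    refine (contMDiffOn_const (c := Module.finBasis ℝ F i)).congr fun x hx => ?_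
    have h := e.continuousLinearMapAt_symmL (R := ℝ) hx (Module.finBasis ℝ F i)
    rwa [Trivialization.continuousLinearMapAt_apply, Trivialization.linearMapAt_apply,
      if_pos hx] at h⟩

theorem frameField_apply (i : Fin (Module.finrank ℝ F)) (x : M) :
    frameField χ i x = (χ x • (trivializationAt F (TangentSpace 𝓘(ℝ, F) : M → Type _) x₀).symmL ℝ x
      (Module.finBasis ℝ F i) : TangentSpace 𝓘(ℝ, F) x) := rfl

/-- For the cut-off coordinates `χ x^i`, the product rule gives `χ d(χ x^i) - (χ x^i) dχ = χ² dx^i`;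
the cut-off frame supplies the third factor `χ`. Only globally defined functions and fields occur,
and both sides vanish outside the chart. -/
theorem smul_eq_sum_frameField (x : M) (y : TangentSpace 𝓘(ℝ, F) x) :
    χ x ^ 3 • y = ∑ i, (χ x * diff (coordFun χ i) x y - coordFun χ i x * diff (bumpFun χ) x y) •
      frameField χ i x := by
  by_cases hx : x ∈ (chartAt F x₀).source
  · let b := Module.finBasis ℝ F
    let e := trivializationAt F (TangentSpace 𝓘(ℝ, F) : M → Type _) x₀
    have hd (i) : χ x * diff (coordFun χ i) x y - coordFun χ i x * diff (bumpFun χ) x y =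
        χ x ^ 2 * b.coord i (e.continuousLinearMapAt ℝ x y) := by
      let c : F →L[ℝ] ℝ := (b.coord i).toContinuousLinearMap
      have hext : MDifferentiableAt 𝓘(ℝ, F) 𝓘(ℝ, F) (extChartAt 𝓘(ℝ, F) x₀) x :=
        mdifferentiableAt_extChartAt hx
      have h1 : MDifferentiableAt 𝓘(ℝ, F) 𝓘(ℝ, ℝ) (c ∘ extChartAt 𝓘(ℝ, F) x₀) x :=
        c.differentiableAt.mdifferentiableAt.comp x hext
      have h2 := mvfderiv_mul (I := 𝓘(ℝ, F)) (x := x) (f := χ)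
        (χ.contMDiff.mdifferentiable (by simp) x) h1
      have h3 := mfderiv_comp_apply (I := 𝓘(ℝ, F)) (I' := 𝓘(ℝ, F)) (I'' := 𝓘(ℝ, ℝ)) x
        (g := c) c.differentiableAt.mdifferentiableAt hext y
      rw [mfderiv_eq_fderiv, ContinuousLinearMap.fderiv,
        ← TangentBundle.continuousLinearMapAt_trivializationAt (I := 𝓘(ℝ, F)) hx] at h3
      have h4 : diff (coordFun χ i) x y =
          χ x * b.coord i (e.continuousLinearMapAt ℝ x y) +
            c (extChartAt 𝓘(ℝ, F) x₀ x) * diff (bumpFun χ) x y := by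
        refine (congrArg (fun φ => φ y) h2).trans ?_
        exact congrArg₂ (· + ·) (congrArg (χ x * ·) h3) rfl
      have h5 : coordFun χ i x = χ x * c (extChartAt 𝓘(ℝ, F) x₀ x) := rfl
      rw [h4, h5]
      ring
    have hy : ∑ i, b.coord i (e.continuousLinearMapAt ℝ x y) • e.symmL ℝ x (b i) = y := by
      have hsum (c : Fin (Module.finrank ℝ F) → ℝ) :
          ∑ i, c i • e.symmL ℝ x (b i) = e.symmL ℝ x (∑ i, c i • b i) := by
        rw [map_sum]; simp only [map_smul]
      rw [hsum]
      have h2 : ∑ i, b.coord i (e.continuousLinearMapAt ℝ x y) • b i =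
        e.continuousLinearMapAt ℝ x y := b.sum_repr _
      rw [h2]
      exact e.symmL_continuousLinearMapAt hx y
    calc χ x ^ 3 • y = χ x ^ 3 • ∑ i, b.coord i (e.continuousLinearMapAt ℝ x y) •
          e.symmL ℝ x (b i) := by rw [hy]
      _ = _ := by
        rw [Finset.smul_sum]
        refine Finset.sum_congr rfl fun i _ => ?_
        rw [hd, frameField_apply]
        module
  · have h0 : χ x = 0 := by
      by_contra h
      exact hx (χ.tsupport_subset_chartAt_source (subset_tsupport _ h))
    have h1 (i) : frameField χ i x = 0 := by
      rw [frameField_apply, h0, zero_smul]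
    simp [h0, h1]

end Frame

/-- The differentials of the smooth functions separate tangent vectors of `M`. -/
theorem eq_zero_of_diff_eq_zero {x : M} {y : TangentSpace 𝓘(ℝ, F) x}
    (h : ∀ f : BaseFun F M, diff f x y = 0) : y = 0 := by
  have h1 := smul_eq_sum_frameField (Classical.arbitrary (SmoothBumpFunction 𝓘(ℝ, F) x)) x y
  simpa [h] using h1

theorem IsSODE.eq_zero {Γ : VField F M} (hΓ : IsSODE Γ) {p : Space F M} {ξ : TSpace p}
    (h1 : dtAt p ξ = 0) (h2 : ∀ f : BaseFun F M, mvfderiv (model F) (pullback f) p ξ = 0)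
    (h3 : ∀ f : BaseFun F M, mvfderiv (model F) (anchor Γ (pullback f)) p ξ = 0) : ξ = 0 := by
  have h4 : dbase p ξ = 0 := by
    refine eq_zero_of_diff_eq_zero (F := F) fun f => ?_
    rw [← mvfderiv_pullback, h2]
  obtain ⟨w, rfl⟩ := exists_vlift_eq p ξ h1 h4
  have hw : w = 0 := by
    refine eq_zero_of_diff_eq_zero (F := F) fun f => ?_
    rw [← hΓ.mvfderiv_velocity_vlift, h3]
  rw [hw, map_zero]

theorem IsSODE.lift_span {Γ : VField F M} (hΓ : IsSODE Γ) (δ : VField F M →ₗ[Fun F M] VField F M)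
    (hδ : ∀ U, IsVerticalLift U → δ U = 0) (X : VField F M) : δ (vertEndoₗ X) = 0 := by
  ext p
  let χ : SmoothBumpFunction 𝓘(ℝ, F) p.2.proj := Classical.arbitrary _
  set Y := vertEndoₗ X with hY
  have hv (f : BaseFun F M) (q : Space F M) :
      anchor Y (anchor Γ (pullback f)) q = diff f q.2.proj (contactAt q (X q)) :=
    hΓ.mvfderiv_velocity_vlift f q _
  -- The frame identity is lifted to `E` with `y` the contact part of `X`. Its coefficients `df(y)`
  -- are the smooth functions `Y(Γ f)`, so the linearity of `δ` applies; at `p` the factor `χ³` is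
  -- `1`.
  have h : pullback (bumpFun χ) ^ 3 • Y =
      ∑ i, (pullback (bumpFun χ) * anchor Y (anchor Γ (pullback (coordFun χ i))) -
        pullback (coordFun χ i) * anchor Y (anchor Γ (pullback (bumpFun χ)))) •
          liftField (frameField χ i) := by
    ext q
    have h1 := congrArg (vlift q) (smul_eq_sum_frameField χ q.2.proj (contactAt q (X q)))
    rw [map_smul, map_sum] at h1
    have hsum (s : Finset (Fin (Module.finrank ℝ F))) (G : Fin (Module.finrank ℝ F) → VField F M) :
        (∑ i ∈ s, G i) q = ∑ i ∈ s, G i q := by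
      exact map_sum ((Pi.evalAddMonoidHom (fun q : Space F M => TSpace q) q).comp
        (ContMDiffSection.coeAddHom (model F) (ℝ × (F × F)) ∞ (fun p : Space F M => TSpace p))) G s
    rw [hsum]
    refine h1.trans (Finset.sum_congr rfl fun i _ => ?_)
    rw [smul_apply, map_smul, ← hv, ← hv]
    rfl
  have h2 := congrArg δ h
  rw [map_smul, map_sum] at h2
  simp only [map_smul, hδ _ (isVerticalLift_liftField _), smul_zero, Finset.sum_const_zero] at h2
  have h3 := congrArg (fun Z : VField F M => Z p) h2
  have h4 : (pullback (bumpFun χ) ^ 3 : Fun F M) p = 1 := by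
    change χ p.2.proj ^ 3 = 1
    rw [χ.eq_one, one_pow]
  have h5 : (pullback (bumpFun χ) ^ 3 : Fun F M) p • (δ Y) p = 0 := h3
  rwa [h4, one_smul] at h5

end Evolution
end

/-! ### Transfer of the algebraic results to the evolution space. -/

noncomputable section

namespace Evolution

variable {F M : Type*} [NormedAddCommGroup F] [NormedSpace ℝ F]
  [TopologicalSpace M] [ChartedSpace F M] [IsManifold 𝓘(ℝ, F) ∞ M]
  [FiniteDimensional ℝ F] [T2Space M]

/-- The second-order structure defined by a second-order field. -/
def IsSODE.structure {Γ : VField F M} (hΓ : IsSODE Γ) :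
    SecondOrderStructure (Fun F M) (VField F M) where
  anchor := anchor
  lie_smul' := lie_smul_field
  anchor_lie := anchor_lie hΓ.anchor_timeFun
  S := vertEndoₗ
  Γ := Γ
  time := timeFun
  base := Set.range pullback
  IsLift := IsVerticalLift
  anchor_Γ_time := hΓ.anchor_timeFun
  anchor_S_time X := by ext p; exact dtAt_vlift p _
  anchor_S_base := by
    rintro X _ ⟨f, rfl⟩
    ext p; exact mvfderiv_pullback_vlift f p _
  anchor_S_velocity := by
    rintro X _ ⟨f, rfl⟩
    ext p
    refine (hΓ.mvfderiv_velocity_vlift f p _).trans ?_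
    have h : (anchor X (pullback f) - anchor X timeFun * anchor Γ (pullback f)) p =
        anchor X (pullback f) p - anchor X timeFun p * anchor Γ (pullback f) p := rfl
    rw [h, hΓ.velocity_apply, contactAt, map_sub, map_smul, ← mvfderiv_pullback]
    rfl
  eq_zero X h1 h2 h3 := by
    ext p
    refine hΓ.eq_zero ?_ (fun f => ?_) fun f => ?_
    · exact congrArg (fun g : Fun F M => g p) h1
    · exact congrArg (fun g : Fun F M => g p) (h2 _ ⟨f, rfl⟩)
    · exact congrArg (fun g : Fun F M => g p) (h3 _ ⟨f, rfl⟩)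
  lift_time := by
    rintro U ⟨W, hW⟩
    ext p
    refine Eq.trans ?_ (dtAt_vlift p (W (p.1, p.2.proj)))
    rw [← hW]; rfl
  lift_base := by
    rintro U ⟨W, hW⟩ _ ⟨f, rfl⟩
    ext p
    refine Eq.trans ?_ (mvfderiv_pullback_vlift f p (W (p.1, p.2.proj)))
    rw [← hW]; rfl
  lift_velocity := by
    rintro U ⟨W, hW⟩ X _ ⟨f, rfl⟩
    ext p
    refine (mvfderiv_vlift _ p _).trans ?_
    -- Along the fibre through `p`, `U(Γ f)` has the constant value `df(W)`.
    have h : (fun v : F => anchor U (anchor Γ (pullback f)) ((p.1, ⟨p.2.proj, v⟩) : Space F M)) =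
        fun _ => diff f p.2.proj (W (p.1, p.2.proj)) := by
      funext v
      refine Eq.trans ?_ (hΓ.mvfderiv_velocity_vlift f (p.1, ⟨p.2.proj, v⟩) (W (p.1, p.2.proj)))
      rw [← hW ((p.1, ⟨p.2.proj, v⟩) : Space F M)]; rfl
    rw [h]
    simp
    rfl
  lift_span := hΓ.lift_span

section Translation

variable {Γ : VField F M}

theorem IsSODE.vertEndo_eq (hΓ : IsSODE Γ) (X : VField F M) : vertEndo X = hΓ.structure.S X := rfl

theorem IsSODE.projΓ_eq (hΓ : IsSODE Γ) (X : VField F M) : projΓ Γ X = hΓ.structure.projΓ X := rfl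

theorem IsSODE.projV_eq (hΓ : IsSODE Γ) (X : VField F M) : projV Γ X = hΓ.structure.projV X :=
  (hΓ.structure.projV_apply X).symm

theorem IsSODE.projH_eq (hΓ : IsSODE Γ) (X : VField F M) : projH Γ X = hΓ.structure.projH X :=
  (hΓ.structure.projH_apply X).symm

theorem IsSODE.horEndo_eq (hΓ : IsSODE Γ) (X : VField F M) : horEndo Γ X = hΓ.structure.Q X := by
  rw [horEndo, hΓ.projH_eq, hΓ.projV_eq]; rfl

theorem IsSODE.massaPagani_eq (hΓ : IsSODE Γ) (X Y : VField F M) :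
    massaPagani Γ X Y = hΓ.structure.conn X Y := by
  -- The bracket term has `dt`-component `(X - P_Γ X)(dt Y)`, because `dt(X - P_Γ X) = 0`; it
  -- completes `(P_Γ X)(dt Y)` to `X(dt Y)`.
  have hΓΓ : extendDeriv (projΓ Γ) (derivΓ Γ) X (projΓ Γ Y) =
      hΓ.structure.anchor X (hΓ.structure.dt Y) • Γ := by
    let A := hΓ.structure
    change A.anchor (A.projΓ X) (A.dt (A.projΓ Y)) • A.Γ + A.projΓ ⁅X - A.projΓ X, A.projΓ Y⁆ =
      A.anchor X (A.dt Y) • A.Γ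
    rw [A.projΓ_apply ⁅X - A.projΓ X, A.projΓ Y⁆, A.dt_lie]
    simp only [A.dt_projΓ, map_sub, sub_self, map_zero, Derivation.sub_apply]
    module
  rw [massaPagani, hΓΓ]
  simp only [extendDeriv, derivH, derivV, hΓ.horEndo_eq, hΓ.projH_eq, hΓ.projV_eq, bracket_eq_lie]
  rw [SecondOrderStructure.conn]
  have h1 : vertEndo (hΓ.structure.projH Y) = hΓ.structure.S Y := hΓ.structure.S_projH Y
  rw [h1, hΓ.structure.Q_projV]
  rfl

theorem IsSODE.isVertical_iff_isVert (hΓ : IsSODE Γ) {X : VField F M} :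
    IsVertical X ↔ hΓ.structure.IsVert X := by
  rw [isVertical_iff]
  constructor
  · intro h
    refine ⟨by ext p; exact (h p).1, ?_⟩
    ext p
    change vlift p (contactAt p (X p)) = 0
    rw [contactAt, (h p).1, (h p).2]
    simp
  · intro h p
    -- Being killed by `dt` and `S` puts `X` in the image of `S`, so it is pointwise a vertical
    -- lift.
    have h1 : vertEndo (horEndo Γ X) = X := by
      rw [hΓ.horEndo_eq]
      exact (hΓ.structure.S_Q X).trans h.projV_eq
    rw [← h1]
    exact ⟨dtAt_vlift p _, dbase_vlift p _⟩

theorem IsSODE.isAdaptedSplitting (hΓ : IsSODE Γ) :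
    IsAdaptedSplitting Γ (projΓ Γ) (projH Γ) (projV Γ) (horEndo Γ) where
  sum_eq X := by
    rw [hΓ.projΓ_eq, hΓ.projH_eq, hΓ.projV_eq]; exact hΓ.structure.proj_sum X
  eigen_zero X := hΓ.structure.lieS_projΓ X
  eigen_neg_one X := by rw [hΓ.projH_eq]; exact hΓ.structure.lieS_projH X
  eigen_one X := by rw [hΓ.projV_eq]; exact hΓ.structure.lieS_projV X
  hor_Q X := by rw [hΓ.projH_eq, hΓ.horEndo_eq]; exact hΓ.structure.projH_Q X
  Q_comp_S X := by rw [hΓ.projH_eq, hΓ.horEndo_eq]; exact hΓ.structure.Q_S X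
  S_comp_Q X := by rw [hΓ.projV_eq, hΓ.horEndo_eq]; exact hΓ.structure.S_Q X

theorem IsSODE.isLinearConnection_massaPagani (hΓ : IsSODE Γ) : IsLinearConnection (massaPagani Γ) where
  add_left X X' Y := by
    simp only [hΓ.massaPagani_eq]; exact hΓ.structure.conn_add_left X X' Y
  mul_left f X Y := by
    simp only [hΓ.massaPagani_eq]; exact hΓ.structure.conn_smul_left f X Y
  add_right X Y Y' := by
    simp only [hΓ.massaPagani_eq]; exact hΓ.structure.conn_add_right X Y Y'
  leibniz f X Y := by
    simp only [hΓ.massaPagani_eq]; exact hΓ.structure.conn_leibniz f X Y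

theorem IsSODE.massaPaganiConditions_massaPagani (hΓ : IsSODE Γ) :
    MassaPaganiConditions Γ (massaPagani Γ) := by
  have hD : massaPagani Γ = hΓ.structure.conn := by
    funext X Y; exact hΓ.massaPagani_eq X Y
  rw [hD]
  exact
    { parallel_Γ := hΓ.structure.conn_Γ
      parallel_dt := fun X Y => sub_eq_zero.2 (hΓ.structure.dt_conn X Y).symm
      parallel_S := fun X Y => sub_eq_zero.2 (hΓ.structure.conn_S X Y)
      parallel_Q := fun X Y => by
        simp only [hΓ.horEndo_eq]; exact sub_eq_zero.2 (hΓ.structure.conn_Q X Y)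
      torsion_H := fun X => by
        rw [hΓ.projH_eq, hΓ.vertEndo_eq, torsion_eq_tors]; exact (hΓ.structure.tors_Γ_S X).symm
      torsion_V := fun X => by
        rw [hΓ.projV_eq, hΓ.vertEndo_eq, torsion_eq_tors]; exact (hΓ.structure.S_tors_Γ X).symm
      curvature_vertical := fun V hV Z =>
        by
        rw [curvature_eq_curv]; exact hΓ.structure.curv_Γ_vert (hΓ.isVertical_iff_isVert.1 hV) Z
      vertical_flat := fun V U hV hU =>
        SecondOrderStructure.conn_lift (A := hΓ.structure) (hΓ.isVertical_iff_isVert.1 hV) hU }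

theorem IsSODE.eq_massaPagani (hΓ : IsSODE Γ) {D : VField F M → VField F M → VField F M}
    (hD : IsLinearConnection D) (h : MassaPaganiConditions Γ D) : D = massaPagani Γ := by
  have h1 : D = hΓ.structure.conn :=
    SecondOrderStructure.eq_conn (A := hΓ.structure) hD.add_left hD.mul_left hD.add_right
      hD.leibniz h.parallel_Γ
      (fun X Y => by
        have h2 := h.parallel_Q X Y
        rw [hΓ.horEndo_eq, hΓ.horEndo_eq] at h2
        exact sub_eq_zero.1 h2)
      (fun X => by rw [← hΓ.projH_eq]; exact (h.torsion_H X).symm)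
      (fun V hV => h.curvature_vertical V (hΓ.isVertical_iff_isVert.2 hV))
      (fun V U hV hU => h.vertical_flat V U (hΓ.isVertical_iff_isVert.2 hV) hU)
  rw [h1]
  funext X Y
  exact (hΓ.massaPagani_eq X Y).symm

end Translation

end Evolution
end

theorem proposition3p3 {F M : Type*} [NormedAddCommGroup F] [NormedSpace ℝ F]
    [FiniteDimensional ℝ F] [TopologicalSpace M] [T2Space M] [ChartedSpace F M]
    [IsManifold (modelWithCornersSelf ℝ F) ((⊤ : ℕ∞) : WithTop ℕ∞) M]
    (Γ : Evolution.VField F M) (hΓ : Evolution.IsSODE Γ) :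
    Evolution.IsAdaptedSplitting Γ (Evolution.projΓ Γ) (Evolution.projH Γ) (Evolution.projV Γ)
        (Evolution.horEndo Γ) ∧
      Evolution.IsLinearConnection (Evolution.massaPagani Γ) ∧
      Evolution.MassaPaganiConditions Γ (Evolution.massaPagani Γ) ∧
      ∀ D : Evolution.VField F M → Evolution.VField F M → Evolution.VField F M,
        Evolution.IsLinearConnection D → Evolution.MassaPaganiConditions Γ D →
          D = Evolution.massaPagani Γ :=
  ⟨hΓ.isAdaptedSplitting, hΓ.isLinearConnection_massaPagani,
    hΓ.massaPaganiConditions_massaPagani, fun _ => hΓ.eq_massaPagani⟩
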